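/- Let $X$ be a compact complex manifold with $\dim_{\mathbb C}X=n$. For $k\ge 0$ let $C^\infty_k(X,\mathbb C)$ be the space of smooth $\mathbb C$-valued $k$-forms on $X$, and for $h\in\mathbb R\setminus\{0\}$ let $d_h:=h\,\partial+\bar\partial: C^\infty_k(X,\mathbb C)\to C^\infty_{k+1}(X,\mathbb C)$. For $k\in\{0,\dots,2n\}$ put $$H^k_{d_h}(X,\mathbb C)=\frac{\ker d_h}{\mathrm{Im}\,d_h},\qquad H^k_{h-BC}(X,\mathbb C)=\frac{\ker d_h\cap\ker d_{-1/h}}{\mathrm{Im}\,(d_h d_{-1/h})},\qquad H^k_{h-A}(X,\mathbb C)=\frac{\ker (d_h d_{-1/h})}{\mathrm{Im}\,d_h+\mathrm{Im}\,d_{-1/h}},$$ all kernels and images being taken in $C^\infty_k(X,\mathbb C)$. Let $b_k=\dim_{\mathbb C} H^k_{DR}(X,\mathbb C)$ be the $k$-th Betti number, and let $$H^{p,q}_{BC}(X,\mathbb C)=\frac{\ker \partial\cap\ker\bar\partial}{\mathrm{Im}\,(\partial\bar\partial)},\qquad H^{p,q}_{A}(X,\mathbb C)=\frac{\ker(\partial\bar\partial)}{\mathrm{Im}\,\partial+\mathrm{Im}\,\bar\partial}$$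 (in bidegree $(p,q)$) be the usual Bott-Chern and Aeppli cohomology groups. The manifold $X$ is called an *$h$-$\partial\bar\partial$-manifold* if for every $k\in\{0,\dots,2n\}$ and every $k$-form $u\in\ker d_h\cap\ker d_{-1/h}$ the following conditions are equivalent: $$u\in\mathrm{Im}\,d_h\iff u\in\mathrm{Im}\,d_{-1/h}\iff u\in\mathrm{Im}\,d\iff u\in\mathrm{Im}\,(d_h d_{-1/h}).$$ Then the following hold. (a) For every $h\in\mathbb R\setminus\{0\}$ and every $k\in\{0,\dots,2n\}$, the canonical linear map $T^{(k)}_h:H^k_{h-BC}(X,\mathbb C)\to H^k_{h-A}(X,\mathbb C)$, $[\alpha]_{h-BC}\mapsto[\alpha]_{h-A}$, is well defined. If $X$ is an $h$-$\partial\bar\partial$-manifold for some fixed $h\in\mathbb R\setminus\{0\}$, then $T_h^{(k)}$ is an isomorphism for every $k\in\{0,\dots,2n\}$. (b) For every $h\in\mathbb R\setminus\{0\}$ and every $k\in\{0,\dots,2n\}$, $$H^k_{h-BC}(X,\mathbb C)=\bigoplus_{p+q=k}H^{p,q}_{BC}(X,\mathbb C),\qquad H^k_{h-A}(X,\mathbb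 C)=\bigoplus_{p+q=k}H^{p,q}_{A}(X,\mathbb C),$$ that is, the canonical maps $[\alpha^{p,q}]\mapsto[\alpha^{p,q}]$ from the groups on the right are well defined and induce isomorphisms from the direct sums. Hence the dimensions of $H^k_{h-BC}(X,\mathbb C)$ and of $H^k_{h-A}(X,\mathbb C)$ are independent of $h$. (c) For every $h\in\mathbb R\setminus\{0\}$ and every $k\in\{0,\dots,2n\}$, the canonical linear maps $H^k_{h-BC}(X,\mathbb C)\to H^k_{d_h}(X,\mathbb C)\to H^k_{h-A}(X,\mathbb C)$, $[\alpha]_{h-BC}\mapsto[\alpha]_{d_h}\mapsto[\alpha]_{h-A}$, are well defined. If $X$ is an $h$-$\partial\bar\partial$-manifold for some fixed $h\in\mathbb R\setminus\{0\}$, then they are isomorphisms for every $k\in\{0,\dots,2n\}$; in particular, the dimensions of the three spaces equal $b_k$. -/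

import Mathlib

open scoped Manifold ContDiff

namespace HTwisted

noncomputable section

/-! ### Local theory on a complex normed space `E`

A complex-valued `k`-form on (an open subset of) `E` is a function
`E → E [⋀^Fin k]→L[ℝ] ℂ`: its values are the alternating `k`-linear forms *over `ℝ`*. -/

section Local

variable {E : Type*} [NormedAddCommGroup E] [NormedSpace ℂ E]

/-- Complex-valued `k`-covectors: alternating `ℝ`-multilinear maps `E ^ k → ℂ`. -/
abbrev Covector (E : Type*) [NormedAddCommGroup E] [NormedSpace ℂ E] (k : ℕ) : Type _ :=
  E [⋀^Fin k]→L[ℝ] ℂ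

/-- The complex structure `v ↦ i v`, as a real-linear endomorphism of `E`. -/
def cplxJ (E : Type*) [NormedAddCommGroup E] [NormedSpace ℂ E] : E →L[ℝ] E :=
  Complex.I • ContinuousLinearMap.id ℝ E

/-- For `a, b : ℂ`, the first order operator sending the form `u` to the antisymmetrisation
of `w ↦ a * Du(w) + b * Du(i w)`. -/
def localOp (a b : ℂ) {k : ℕ} (u : E → Covector E k) (z : E) : Covector E (k + 1) :=
  ContinuousAlternatingMap.alternatizeUncurryFin
    (a • fderiv ℝ u z + b • (fderiv ℝ u z).comp (cplxJ E))

/-- With `a = 1` and `b = 0` one gets the exterior derivative. -/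
theorem localOp_one_zero {k : ℕ} (u : E → Covector E k) : localOp 1 0 u = extDeriv u := by
  funext z
  simp [localOp, extDeriv]

theorem localOp_add (a b : ℂ) {k : ℕ} {u v : E → Covector E k} {z : E}
    (hu : DifferentiableAt ℝ u z) (hv : DifferentiableAt ℝ v z) :
    localOp a b (u + v) z = localOp a b u z + localOp a b v z := by
  simp only [localOp, fderiv_add hu hv, ← ContinuousAlternatingMap.alternatizeUncurryFin_add]
  congr 1
  ext w : 1
  simp
  abel

theorem localOp_smul (a b : ℂ) {k : ℕ} (s : ℂ) {u : E → Covector E k} {z : E}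
    (hu : DifferentiableAt ℝ u z) :
    localOp a b (s • u) z = s • localOp a b u z := by
  simp only [localOp, fderiv_const_smul hu s,
    ← ContinuousAlternatingMap.alternatizeUncurryFin_smul]
  congr 1
  ext w : 1
  simp [smul_comm s]

theorem localOp_congr (a b : ℂ) {k : ℕ} {u v : E → Covector E k} {z : E}
    (h : u =ᶠ[nhds z] v) : localOp a b u z = localOp a b v z := by
  simp only [localOp, h.fderiv_eq]

theorem localOp_contDiffOn (a b : ℂ) {k : ℕ} {u : E → Covector E k} {s : Set E}
    (hs : IsOpen s) (hu : ContDiffOn ℝ ∞ u s) : ContDiffOn ℝ ∞ (localOp a b u) s := by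
  have h1 : ContDiffOn ℝ ∞ (fderiv ℝ u) s := hu.fderiv_of_isOpen hs (by simp)
  have h2 : ContDiffOn ℝ ∞ (fun z => (fderiv ℝ u z).comp (cplxJ E)) s :=
    h1.clm_comp contDiffOn_const
  exact (ContinuousAlternatingMap.alternatizeUncurryFinCLM ℝ E ℂ).contDiff.comp_contDiffOn
    ((h1.const_smul a).add (h2.const_smul b))

/-- `localOp a b` commutes with pullback under holomorphic maps. -/
theorem localOp_pullback (a b : ℂ) {k : ℕ} {u : E → Covector E k} {f : E → E} {z : E}
    (hu : DifferentiableAt ℝ u (f z)) (hf : ContDiffAt ℂ ω f z) :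
    localOp a b (fun y => (u (f y)).compContinuousLinearMap (fderiv ℝ f y)) z =
      (localOp a b u (f z)).compContinuousLinearMap (fderiv ℝ f z) := by
  have hfR : ContDiffAt ℝ ω f z := hf.restrict_scalars ℝ
  have hfd : DifferentiableAt ℝ f z := hfR.differentiableAt (by simp)
  have hfd2 : DifferentiableAt ℝ (fderiv ℝ f) z :=
    (hfR.fderiv_right (m := 1) le_top).differentiableAt one_ne_zero
  have hsymm : ∀ v w, fderiv ℝ (fderiv ℝ f) z v w = fderiv ℝ (fderiv ℝ f) z w v :=
    (hfR.isSymmSndFDerivAt (by simp)).eq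
  have hcd : DifferentiableAt ℂ f z := hf.differentiableAt (by simp)
  have hcd2 : DifferentiableAt ℂ (fderiv ℂ f) z :=
    (hf.fderiv_right (m := 1) le_top).differentiableAt one_ne_zero
  have hev : ∀ᶠ y in nhds z, fderiv ℝ f y = (fderiv ℂ f y).restrictScalars ℝ := by
    have h1 : ∀ᶠ y in nhds z, ContDiffAt ℂ 1 f y :=
      (hf.of_le le_top).eventually (by simp)
    filter_upwards [h1] with y hy
    exact (hy.differentiableAt one_ne_zero).fderiv_restrictScalars ℝ
  have hJ1 : ∀ v, fderiv ℝ f z (cplxJ E v) = cplxJ E (fderiv ℝ f z v) := by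
    intro v
    rw [hev.self_of_nhds]
    simp [cplxJ]
  have hD2 : ∀ v w, fderiv ℝ (fderiv ℝ f) z v w = fderiv ℂ (fderiv ℂ f) z v w := by
    intro v w
    have h1 := (ContinuousLinearMap.restrictScalarsL ℂ E E ℝ ℝ).hasFDerivAt.comp z
      (hcd2.hasFDerivAt.restrictScalars ℝ)
    have h2 : fderiv ℝ (fderiv ℝ f) z = _ := (h1.congr_of_eventuallyEq hev).fderiv
    rw [h2]
    rfl
  have hzero : ∀ B : E →L[ℝ] E →L[ℝ] E, (∀ v w, B v w = B w v) →
      ContinuousAlternatingMap.alternatizeUncurryFin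
        ((u (f z)).fderivCompContinuousLinearMap (fderiv ℝ f z) ∘L B) = 0 := fun B hB =>
    ContinuousAlternatingMap.alternatizeUncurryFin_fderivCompContinuousLinearMap_eq_zero _ _ hB
  have hz1 := hzero _ hsymm
  have hz2 := hzero ((fderiv ℝ (fderiv ℝ f) z).comp (cplxJ E)) (by
    intro v w
    simp only [ContinuousLinearMap.comp_apply]
    rw [hsymm (cplxJ E w) v, hD2, hD2]
    simp only [cplxJ, _root_.smul_apply, ContinuousLinearMap.id_apply, map_smul])
  have hD : fderiv ℝ (fun y => (u (f y)).compContinuousLinearMap (fderiv ℝ f y)) z = _ :=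
    fderiv_continuousAlternatingMapCompContinuousLinearMap
      (f := fun y => u (f y)) (hu.comp z hfd) hfd2
  have hc : fderiv ℝ (fun y => u (f y)) z = (fderiv ℝ u (f z)).comp (fderiv ℝ f z) :=
    fderiv_comp z hu hfd
  rw [hc] at hD
  rw [localOp, hD]
  have key : (a • (ContinuousAlternatingMap.compContinuousLinearMapCLM (fderiv ℝ f z) ∘L
        ((fderiv ℝ u (f z)).comp (fderiv ℝ f z)) +
        (u (f z)).fderivCompContinuousLinearMap (fderiv ℝ f z) ∘L fderiv ℝ (fderiv ℝ f) z) +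
      b • ContinuousLinearMap.comp
        (ContinuousAlternatingMap.compContinuousLinearMapCLM (fderiv ℝ f z) ∘L
        ((fderiv ℝ u (f z)).comp (fderiv ℝ f z)) +
        (u (f z)).fderivCompContinuousLinearMap (fderiv ℝ f z) ∘L fderiv ℝ (fderiv ℝ f) z)
        (cplxJ E)) =
      ContinuousAlternatingMap.compContinuousLinearMapCLM (fderiv ℝ f z) ∘L
        ((a • fderiv ℝ u (f z) + b • (fderiv ℝ u (f z)).comp (cplxJ E)).comp (fderiv ℝ f z)) +
      (a • ((u (f z)).fderivCompContinuousLinearMap (fderiv ℝ f z) ∘L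
          fderiv ℝ (fderiv ℝ f) z) +
        b • ((u (f z)).fderivCompContinuousLinearMap (fderiv ℝ f z) ∘L
          (fderiv ℝ (fderiv ℝ f) z).comp (cplxJ E))) := by
    ext w v
    simp [hJ1]
    ring
  rw [key]
  simp only [ContinuousAlternatingMap.alternatizeUncurryFin_add,
    ContinuousAlternatingMap.alternatizeUncurryFin_smul, hz1, hz2, smul_zero, add_zero]
  ext v
  simp +unfoldPartialApp [localOp, ContinuousAlternatingMap.alternatizeUncurryFin_apply,
    Fin.removeNth, Function.comp_def]
  simp only [Finset.mul_sum, mul_left_comm]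

/-- The real-alternating form `α` is of type `(p, q)`: scaling all the arguments by `s : ℂ`
multiplies `α` by `s ^ p * conj s ^ q`. -/
def IsOfType (p q : ℕ) {k : ℕ} (α : Covector E k) : Prop :=
  ∀ (s : ℂ) (v : Fin k → E),
    α (fun i => s • v i) = s ^ p * (starRingEnd ℂ s) ^ q * α v

end Local

/-! ### Differential forms on a complex manifold

`X` is a complex manifold modelled on `E`: a charted space with analytic (= holomorphic)
transition maps. -/

section Manifold

variable (E : Type*) [NormedAddCommGroup E] [NormedSpace ℂ E]
  (X : Type*) [TopologicalSpace X] [ChartedSpace E X]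

/-- The transition map from the chart `c` to the chart `c'`. Its natural domain is
`(transition E X c c').source = c (c.source ∩ c'.source)`. -/
def transition (c c' : atlas E X) : OpenPartialHomeomorph E E :=
  c.1.symm.trans c'.1

/-- Smooth complex-valued `k`-forms on `X`, as a space of functions: families of smooth
`k`-forms on the images `c.target ⊆ E` of the charts `c` that correspond to one another by pullback under the transition maps. (The values outside `c.target` are meaningless and are
normalised to be `0`.) -/
def smoothForms (k : ℕ) : Submodule ℂ (atlas E X → E → Covector E k) where
  carrier := {u |
    (∀ c : atlas E X, ContDiffOn ℝ ∞ (u c) c.1.target) ∧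
    (∀ c c' : atlas E X, ∀ z ∈ (transition E X c c').source,
      u c z = (u c' (transition E X c c' z)).compContinuousLinearMap
        (fderiv ℝ (transition E X c c') z)) ∧
    (∀ c : atlas E X, ∀ z ∉ c.1.target, u c z = 0)}
  add_mem' := by
    rintro u v ⟨hu1, hu2, hu3⟩ ⟨hv1, hv2, hv3⟩
    refine ⟨fun c => (hu1 c).add (hv1 c), fun c c' z hz => ?_, fun c z hz => ?_⟩
    · ext w
      simp [hu2 c c' z hz, hv2 c c' z hz]
    · simp [hu3 c z hz, hv3 c z hz]
  zero_mem' := ⟨fun c => contDiffOn_const, fun c c' z hz => by ext w; simp, fun c z hz => rfl⟩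
  smul_mem' := by
    rintro s u ⟨hu1, hu2, hu3⟩
    refine ⟨fun c => (hu1 c).const_smul s, fun c c' z hz => ?_, fun c z hz => ?_⟩
    · ext w
      simp [hu2 c c' z hz]
    · simp [hu3 c z hz]

/-- The complex vector space `C^∞_k(X, ℂ)` of smooth complex-valued `k`-forms on `X`. -/
def Form (k : ℕ) : Type _ := smoothForms E X k

instance (k : ℕ) : AddCommGroup (Form E X k) :=
  inferInstanceAs (AddCommGroup (smoothForms E X k))

instance (k : ℕ) : Module ℂ (Form E X k) :=
  inferInstanceAs (Module ℂ (smoothForms E X k))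

variable {E X}

theorem Form.ext_target {k : ℕ} {u v : Form E X k}
    (h : ∀ (c : atlas E X), ∀ z ∈ c.1.target, u.1 c z = v.1 c z) : u = v := by
  apply Subtype.ext
  funext c z
  by_cases hz : z ∈ c.1.target
  · exact h c z hz
  · exact (u.2.2.2 c z hz).trans (v.2.2.2 c z hz).symm

theorem Form.add_val {k : ℕ} (u v : Form E X k) : (u + v).1 = u.1 + v.1 := rfl

theorem Form.smul_val {k : ℕ} (s : ℂ) (u : Form E X k) : (s • u).1 = s • u.1 := rfl

theorem Form.zero_val {k : ℕ} : (0 : Form E X k).1 = 0 := rfl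

set_option linter.unusedSectionVars false in
theorem transition_source {c c' : atlas E X} {z : E} (hz : z ∈ (transition E X c c').source) :
    z ∈ c.1.target ∧ transition E X c c' z ∈ c'.1.target := by
  have h := hz
  simp only [transition, OpenPartialHomeomorph.trans_source, OpenPartialHomeomorph.symm_source,
    Set.mem_inter_iff, Set.mem_preimage] at h
  exact ⟨h.1, c'.1.map_source h.2⟩

theorem Form.differentiableAt {k : ℕ} (u : Form E X k) (c : atlas E X) {z : E}
    (hz : z ∈ c.1.target) : DifferentiableAt ℝ (u.1 c) z :=
  ((u.2.1 c).contDiffAt (c.1.open_target.mem_nhds hz)).differentiableAt (by simp)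

theorem transition_contDiffAt [IsManifold 𝓘(ℂ, E) ω X] (c c' : atlas E X) {z : E}
    (hz : z ∈ (transition E X c c').source) : ContDiffAt ℂ ω (transition E X c c') z := by
  have h := (contDiffGroupoid ω 𝓘(ℂ, E)).compatible c.2 c'.2
  rw [contDiffGroupoid, mem_groupoid_of_pregroupoid] at h
  have h2 : ContDiffOn ℂ ω (transition E X c c') (transition E X c c').source := by
    simpa [contDiffPregroupoid, transition] using h.1
  exact h2.contDiffAt ((transition E X c c').open_source.mem_nhds hz)

/-- The form that is given by `localOp a b u` in every chart. -/
def chartFun [IsManifold 𝓘(ℂ, E) ω X] (a b : ℂ) (k : ℕ) (u : Form E X k) : Form E X (k + 1) :=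
  ⟨fun c => c.1.target.indicator (localOp a b (u.1 c)), by
    refine ⟨fun c => ?_, fun c c' z hz => ?_, fun c z hz => Set.indicator_of_notMem hz _⟩
    · exact (localOp_contDiffOn a b c.1.open_target (u.2.1 c)).congr
        fun z hz => Set.indicator_of_mem hz _
    · obtain ⟨h1, h2⟩ := transition_source hz
      beta_reduce
      rw [Set.indicator_of_mem h1, Set.indicator_of_mem h2,
        ← localOp_pullback a b (u.differentiableAt c' h2) (transition_contDiffAt c c' hz)]
      apply localOp_congr
      filter_upwards [(transition E X c c').open_source.mem_nhds hz] with y hy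
      exact u.2.2.1 c c' y hy⟩

theorem chartFun_mem [IsManifold 𝓘(ℂ, E) ω X] (a b : ℂ) {k : ℕ} (u : Form E X k)
    (c : atlas E X) {z : E} (hz : z ∈ c.1.target) :
    (chartFun a b k u).1 c z = localOp a b (u.1 c) z :=
  Set.indicator_of_mem hz _

/-- The linear operator on forms that is given by `localOp a b` in every chart. -/
def chartOp [IsManifold 𝓘(ℂ, E) ω X] (a b : ℂ) (k : ℕ) :
    Form E X k →ₗ[ℂ] Form E X (k + 1) where
  toFun := chartFun a b k
  map_add' u v := by
    apply Form.ext_target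
    intro c z hz
    simp only [Form.add_val, Pi.add_apply, chartFun_mem _ _ _ _ hz]
    exact localOp_add a b (u.differentiableAt c hz) (v.differentiableAt c hz)
  map_smul' s u := by
    apply Form.ext_target
    intro c z hz
    simp only [Form.smul_val, Pi.smul_apply, chartFun_mem _ _ _ _ hz, RingHom.id_apply]
    exact localOp_smul a b s (u.differentiableAt c hz)

theorem chartOp_mem [IsManifold 𝓘(ℂ, E) ω X] (a b : ℂ) {k : ℕ} (u : Form E X k)
    (c : atlas E X) {z : E} (hz : z ∈ c.1.target) :
    (chartOp a b k u).1 c z = localOp a b (u.1 c) z :=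
  chartFun_mem a b u c hz

variable (E X)
variable [IsManifold 𝓘(ℂ, E) ω X]

/-- The exterior derivative `d : C^∞_k(X, ℂ) → C^∞_{k+1}(X, ℂ)`; see `d_apply`. -/
def d (k : ℕ) : Form E X k →ₗ[ℂ] Form E X (k + 1) := chartOp 1 0 k

/-- The operator `∂`. In a chart, `∂u` is the antisymmetrisation of the `ℂ`-linear part
`w ↦ (1/2) (Du(w) - i Du(i w))` of the derivative of `u`; that is,
`∂u = ∑ j, dz_j ∧ ∂u/∂z_j`, the derivatives `∂/∂z_j` being applied to the coefficients of `u`. -/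
def del (k : ℕ) : Form E X k →ₗ[ℂ] Form E X (k + 1) :=
  chartOp (1 / 2) (-(Complex.I / 2)) k

/-- The operator `∂̄`. In a chart, `∂̄u` is the antisymmetrisation of the conjugate-linear part
`w ↦ (1/2) (Du(w) + i Du(i w))` of the derivative of `u`; that is,
`∂̄u = ∑ j, dz̄_j ∧ ∂u/∂z̄_j`. -/
def delbar (k : ℕ) : Form E X k →ₗ[ℂ] Form E X (k + 1) :=
  chartOp (1 / 2) (Complex.I / 2) k

/-- The twisted differential `d_h = h ∂ + ∂̄`. -/
def dh (h : ℝ) (k : ℕ) : Form E X k →ₗ[ℂ] Form E X (k + 1) :=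
  (h : ℂ) • del E X k + delbar E X k

variable {E X} in
/-- In every chart, `d` is Mathlib's exterior derivative. -/
theorem d_apply {k : ℕ} (u : Form E X k) (c : atlas E X) {z : E} (hz : z ∈ c.1.target) :
    (d E X k u).1 c z = extDeriv (u.1 c) z := by
  rw [d, chartOp_mem _ _ _ _ hz, localOp_one_zero]

/-- `d = ∂ + ∂̄`. -/
theorem d_eq_del_add_delbar (k : ℕ) : d E X k = del E X k + delbar E X k := by
  ext u : 1
  apply Form.ext_target
  intro c z hz
  rw [LinearMap.add_apply, Form.add_val, Pi.add_apply, Pi.add_apply, d, del, delbar,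
    chartOp_mem _ _ _ _ hz, chartOp_mem _ _ _ _ hz, chartOp_mem _ _ _ _ hz]
  simp only [localOp, ← ContinuousAlternatingMap.alternatizeUncurryFin_add]
  congr 1
  module

/-- The space `C^∞_{p,q}(X, ℂ)` of smooth forms of type `(p, q)`, as a subspace of the space of
`k`-forms, where `k = p + q`. -/
def FormType (k p q : ℕ) : Submodule ℂ (Form E X k) where
  carrier := {u | ∀ (c : atlas E X), ∀ z ∈ c.1.target, IsOfType p q (u.1 c z)}
  add_mem' := by
    intro u v hu hv c z hz s w
    simpa [mul_add, Form.add_val] using congrArg₂ (· + ·) (hu c z hz s w) (hv c z hz s w)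
  zero_mem' := by
    intro c z hz s w
    simp [Form.zero_val]
  smul_mem' := by
    intro t u hu c z hz s w
    simpa [mul_left_comm, Form.smul_val] using congrArg (t * ·) (hu c z hz s w)

/-! ### Cohomology groups -/

/-- The image in degree `k` of an operator of degree `1`. -/
def imOf (D : ∀ k, Form E X k →ₗ[ℂ] Form E X (k + 1)) : ∀ k, Submodule ℂ (Form E X k)
  | 0 => ⊥
  | k + 1 => LinearMap.range (D k)

/-- The image in degree `k` of the composition `D D'` of two operators of degree `1`. -/
def imOfComp (D D' : ∀ k, Form E X k →ₗ[ℂ] Form E X (k + 1)) : ∀ k, Submodule ℂ (Form E X k)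
  | 0 => ⊥
  | 1 => ⊥
  | k + 2 => LinearMap.range (D (k + 1) ∘ₗ D' k)

/-- `X` is an `h`-`∂∂̄`-manifold: for every `k ≤ 2 dim_ℂ X` and every `k`-form `u` in
`ker d_h ∩ ker d_{-1/h}`, the four exactness conditions are equivalent. -/
def IsHDelDelbarManifold (h : ℝ) : Prop :=
  ∀ k ≤ 2 * Module.finrank ℂ E,
    ∀ u ∈ LinearMap.ker (dh E X h k) ⊓ LinearMap.ker (dh E X (-(1 / h)) k),
      [u ∈ imOf E X (dh E X h) k,
        u ∈ imOf E X (dh E X (-(1 / h))) k,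
        u ∈ imOf E X (d E X) k,
        u ∈ imOfComp E X (dh E X h) (dh E X (-(1 / h))) k].TFAE

section Subquotient

variable {V : Type*} [AddCommGroup V] [Module ℂ V]

/-- The quotient `Z / B` of two subspaces `B ⊆ Z` of `V`. -/
def Subquotient (Z B : Submodule ℂ V) : Type _ := Z ⧸ B.submoduleOf Z

instance (Z B : Submodule ℂ V) : AddCommGroup (Subquotient Z B) :=
  inferInstanceAs (AddCommGroup (Z ⧸ B.submoduleOf Z))

instance (Z B : Submodule ℂ V) : Module ℂ (Subquotient Z B) :=
  inferInstanceAs (Module ℂ (Z ⧸ B.submoduleOf Z))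

/-- The class of `α ∈ Z` in `Z / B`. -/
def cls (Z B : Submodule ℂ V) {α : V} (hα : α ∈ Z) : Subquotient Z B :=
  (B.submoduleOf Z).mkQ ⟨α, hα⟩

/-- `T : Z / B → Z' / B'` is the canonical map `[α] ↦ [α]`: every representative `α ∈ Z` lies
in `Z'`, and `T` sends the class of `α` in `Z / B` to the class of `α` in `Z' / B'`. -/
def IsCanonical {Z B Z' B' : Submodule ℂ V} (T : Subquotient Z B →ₗ[ℂ] Subquotient Z' B') :
    Prop :=
  ∀ (α : V) (hα : α ∈ Z), ∃ hα' : α ∈ Z', T (cls Z B hα) = cls Z' B' hα'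

end Subquotient

/-- `H^k_{DR}(X, ℂ)`. -/
abbrev HDR (k : ℕ) : Type _ :=
  Subquotient (LinearMap.ker (d E X k)) (imOf E X (d E X) k)

/-- The `k`-th Betti number `b_k = dim H^k_{DR}(X, ℂ)` (a dimension, hence a cardinal). -/
def betti (k : ℕ) : Cardinal := Module.rank ℂ (HDR E X k)

/-- `H^k_{d_h}(X, ℂ)`. -/
abbrev Hdh (h : ℝ) (k : ℕ) : Type _ :=
  Subquotient (LinearMap.ker (dh E X h k)) (imOf E X (dh E X h) k)

/-- `H^k_{h-BC}(X, ℂ) = (ker d_h ∩ ker d_{-1/h}) / Im (d_h d_{-1/h})`. -/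
abbrev HhBC (h : ℝ) (k : ℕ) : Type _ :=
  Subquotient (LinearMap.ker (dh E X h k) ⊓ LinearMap.ker (dh E X (-(1 / h)) k))
    (imOfComp E X (dh E X h) (dh E X (-(1 / h))) k)

/-- `H^k_{h-A}(X, ℂ) = ker (d_h d_{-1/h}) / (Im d_h + Im d_{-1/h})`. -/
abbrev HhA (h : ℝ) (k : ℕ) : Type _ :=
  Subquotient (LinearMap.ker (dh E X h (k + 1) ∘ₗ dh E X (-(1 / h)) k))
    (imOf E X (dh E X h) k ⊔ imOf E X (dh E X (-(1 / h))) k)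

/-- The space `∂∂̄ C^∞_{p-1,q-1}(X, ℂ)` of `k`-forms, where `k = p + q`. -/
def imDelDelbarType : (k p q : ℕ) → Submodule ℂ (Form E X k)
  | k + 2, p + 1, q + 1 => (FormType E X k p q).map (del E X (k + 1) ∘ₗ delbar E X k)
  | _, _, _ => ⊥

/-- The space `∂ C^∞_{p-1,q}(X, ℂ)` of `k`-forms, where `k = p + q`. -/
def imDelType : (k p q : ℕ) → Submodule ℂ (Form E X k)
  | k + 1, p + 1, q => (FormType E X k p q).map (del E X k)
  | _, _, _ => ⊥

/-- The space `∂̄ C^∞_{p,q-1}(X, ℂ)` of `k`-forms, where `k = p + q`. -/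
def imDelbarType : (k p q : ℕ) → Submodule ℂ (Form E X k)
  | k + 1, p, q + 1 => (FormType E X k p q).map (delbar E X k)
  | _, _, _ => ⊥

/-- The Bott-Chern cohomology group `H^{p,q}_{BC}(X, ℂ)`, i.e. `ker ∂ ∩ ker ∂̄` modulo `Im ∂∂̄` in
bidegree `(p, q)`, where `k = p + q`. -/
abbrev HBC (k p q : ℕ) : Type _ :=
  Subquotient (FormType E X k p q ⊓ LinearMap.ker (del E X k) ⊓ LinearMap.ker (delbar E X k))
    (imDelDelbarType E X k p q)

/-- The Aeppli cohomology group `H^{p,q}_A(X, ℂ)`, i.e. `ker ∂∂̄` modulo `Im ∂ + Im ∂̄` in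
bidegree `(p, q)`, where `k = p + q`. -/
abbrev HA (k p q : ℕ) : Type _ :=
  Subquotient (FormType E X k p q ⊓ LinearMap.ker (del E X (k + 1) ∘ₗ delbar E X k))
    (imDelType E X k p q ⊔ imDelbarType E X k p q)

end Manifold

end

end HTwisted

namespace HTwisted

/-! ### Rescaling arguments of covectors by a complex number -/

section Local

variable {E : Type*} [NormedAddCommGroup E] [NormedSpace ℂ E]

/-! The type decomposition is obtained without coordinates, from the operators `scale s` that
multiply all arguments of a form by `s`. Forms of type (p, q) are their common eigenvectors, with
eigenvalue s^p s̄^q, and a Vandermonde inversion writes each type projection as a finite combination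
of rescalings (`sum_typeProj`, `typeProj_mem`). Rescaling multiplies ∂ by s and ∂̄ by s̄, so d² = 0,
conjugated by rescalings, splits into ∂² = ∂̄² = ∂∂̄ + ∂̄∂ = 0 (`del_delbar_relations`).

Since h ≠ -1/h, the pair d_h, d_{-1/h} is an invertible combination of ∂, ∂̄, and d_h d_{-1/h} is a
nonzero multiple of ∂∂̄. The h-Bott-Chern and h-Aeppli groups are therefore those of ∂, ∂̄ on
k-forms. Their numerators and denominators are stable under type projections, which gives (b) and
independence of h.

For (a) and (c), on an h-∂∂̄-manifold a form closed for both operators and exact for one equals ∂∂̄β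
(`IsHDelDelbarManifold.exists_primitives`). Correcting a representative by an exact form built from
β makes it closed for the operators still missing, without changing its class; this yields
surjectivity. Injectivity comes from the equivalent exactness conditions. The same argument compares
h-Bott-Chern with de Rham cohomology, hence the Betti numbers. -/

/-- Multiplication by `s : ℂ`, as a real-linear endomorphism of `E`. -/
noncomputable def cplxScale (E : Type*) [NormedAddCommGroup E] [NormedSpace ℂ E] (s : ℂ) :
    E →L[ℝ] E :=
  s • ContinuousLinearMap.id ℝ E

@[simp]
theorem cplxScale_apply (s : ℂ) (v : E) : cplxScale E s v = s • v := rfl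

theorem smul_eq_re_smul_add_im_smul (s : ℂ) (v : E) :
    s • v = s.re • v + s.im • (Complex.I • v) := by
  conv_lhs => rw [← Complex.re_add_im s]
  rw [add_smul, mul_smul, Complex.coe_smul, Complex.coe_smul]

theorem fderiv_scale {k : ℕ} {u : E → Covector E k} {z : E} (hu : DifferentiableAt ℝ u z)
    (s : ℂ) :
    fderiv ℝ (fun y => (u y).compContinuousLinearMap (cplxScale E s)) z =
      (ContinuousAlternatingMap.compContinuousLinearMapCLM (cplxScale E s)).comp
        (fderiv ℝ u z) :=
  ((ContinuousAlternatingMap.compContinuousLinearMapCLM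
    (cplxScale E s) : Covector E k →L[ℝ] Covector E k).hasFDerivAt.comp z hu.hasFDerivAt).fderiv

theorem localOp_apply (a b : ℂ) {k : ℕ} (u : E → Covector E k) (z : E) (v : Fin (k + 1) → E) :
    localOp a b u z v = ∑ i : Fin (k + 1), (-1) ^ (i : ℕ) •
      (a * fderiv ℝ u z (v i) (i.removeNth v) +
        b * fderiv ℝ u z (Complex.I • v i) (i.removeNth v)) := by
  simp [localOp, ContinuousAlternatingMap.alternatizeUncurryFin_apply, cplxJ,
    Finset.mul_sum, Finset.sum_add_distrib, mul_left_comm]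

/-- The hypotheses say that (a, b) is an eigenvector, with eigenvalue t, of the substitution w ↦ s w
in a Du(w) + b Du(i w). For ∂ the eigenvalue is s, for ∂̄ it is s̄. -/
theorem localOp_scale {a b s t : ℂ}
    (ha : a * s.re - b * s.im = t * a) (hb : a * s.im + b * s.re = t * b) {k : ℕ}
    {u : E → Covector E k} {z : E} (hu : DifferentiableAt ℝ u z) :
    (localOp a b u z).compContinuousLinearMap (cplxScale E s) =
      t • localOp a b (fun y => (u y).compContinuousLinearMap (cplxScale E s)) z := by
  ext v
  simp only [ContinuousAlternatingMap.compContinuousLinearMap_apply,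
    ContinuousAlternatingMap.smul_apply, localOp_apply, fderiv_scale hu, Finset.smul_sum]
  refine Finset.sum_congr rfl fun i _ => ?_
  have e1 : (i.removeNth (cplxScale E s ∘ v)) = cplxScale E s ∘ i.removeNth v := rfl
  have e2 : fderiv ℝ u z (s • v i) = s.re • fderiv ℝ u z (v i) +
      s.im • fderiv ℝ u z (Complex.I • v i) := by
    rw [smul_eq_re_smul_add_im_smul, map_add, map_smul, map_smul]
  have e3 : fderiv ℝ u z (Complex.I • s • v i) = s.re • fderiv ℝ u z (Complex.I • v i) -
      s.im • fderiv ℝ u z (v i) := by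
    rw [smul_comm, smul_eq_re_smul_add_im_smul, map_add, (fderiv ℝ u z).map_smul,
      (fderiv ℝ u z).map_smul, smul_smul, Complex.I_mul_I, neg_one_smul, map_neg, smul_neg,
      sub_eq_add_neg]
  rw [e1]
  simp only [Function.comp_apply, cplxScale_apply, e2, e3, ContinuousLinearMap.comp_apply,
    ContinuousAlternatingMap.compContinuousLinearMapCLM_apply,
    ContinuousAlternatingMap.compContinuousLinearMap_apply,
    ContinuousAlternatingMap.add_apply, ContinuousAlternatingMap.sub_apply,
    ContinuousAlternatingMap.smul_apply, Complex.real_smul]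
  rw [smul_comm t]
  congr 1
  rw [smul_eq_mul]
  linear_combination (fderiv ℝ u z (v i) (cplxScale E s ∘ i.removeNth v)) * ha +
    (fderiv ℝ u z (Complex.I • v i) (cplxScale E s ∘ i.removeNth v)) * hb

/-- By real multilinearity, each argument s v = Re(s) v + Im(s) i v contributes one factor linear in
s and s̄; induction peels off the first argument. -/
theorem exists_scale_expansion {k : ℕ} (f : MultilinearMap ℝ (fun _ : Fin k => E) ℂ)
    (v : Fin k → E) :
    ∃ a : ℕ → ℂ, ∀ s : ℂ, f (fun i => s • v i) =
      ∑ p ∈ Finset.range (k + 1), s ^ p * (starRingEnd ℂ s) ^ (k - p) * a p := by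
  induction k with
  | zero => exact ⟨fun _ => f v, fun s => by simp; congr 1; ext i; exact i.elim0⟩
  | succ k ih =>
    obtain ⟨a, ha⟩ := ih (f.curryLeft (v 0)) (Fin.tail v)
    obtain ⟨b, hb⟩ := ih (f.curryLeft (Complex.I • v 0)) (Fin.tail v)
    -- Re(s) a + Im(s) b = s (a - i b)/2 + s̄ (a + i b)/2, so the coefficient of index p collects
    -- the s-part of index p - 1 and the s̄-part of index p. The conditionals drop the two parts
    -- that do not exist at the ends.
    refine ⟨fun p => (if p = 0 then 0 else (a (p - 1) - Complex.I * b (p - 1)) / 2) +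
      if p = k + 1 then 0 else (a p + Complex.I * b p) / 2, fun s => ?_⟩
    have h0 : f (fun i => s • v i) =
        s.re * f.curryLeft (v 0) (fun i => s • Fin.tail v i) +
        s.im * f.curryLeft (Complex.I • v 0) (fun i => s • Fin.tail v i) := by
      have : (fun i => s • v i) = Fin.cons (s • v 0) (fun i => s • Fin.tail v i) := by
        ext i
        refine Fin.cases ?_ (fun j => ?_) i <;> simp [Fin.tail]
      rw [this, ← MultilinearMap.curryLeft_apply, smul_eq_re_smul_add_im_smul s (v 0), map_add,
        map_smul, map_smul]
      simp
    rw [h0, ha, hb]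
    simp only [mul_add, Finset.sum_add_distrib]
    rw [Finset.sum_range_succ' (fun p => s ^ p * (starRingEnd ℂ s) ^ (k + 1 - p) *
        (if p = 0 then 0 else (a (p - 1) - Complex.I * b (p - 1)) / 2)),
      Finset.sum_range_succ (fun p => s ^ p * (starRingEnd ℂ s) ^ (k + 1 - p) *
        (if p = k + 1 then 0 else (a p + Complex.I * b p) / 2))]
    simp only [if_true, mul_zero, add_zero, Finset.mul_sum]
    rw [← Finset.sum_add_distrib, ← Finset.sum_add_distrib]
    refine Finset.sum_congr rfl fun p hp => ?_
    have hp' : p < k + 1 := Finset.mem_range.1 hp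
    rw [if_neg (Nat.succ_ne_zero p), if_neg hp'.ne, Nat.add_sub_add_right, Nat.add_sub_cancel,
      Nat.succ_sub (Nat.lt_succ_iff.1 hp'), pow_succ, pow_succ, Complex.re_eq_add_conj,
      Complex.im_eq_sub_conj]
    field_simp
    linear_combination (s ^ p * (starRingEnd ℂ s) ^ (k - p)) *
      ((s - starRingEnd ℂ s) * b p * Complex.I_sq)

end Local

/-! ### Vandermonde inversion for the monomials s^p s̄^(k-p) -/

section Coefficients

/-- The points `1 + i j`, at which forms are sampled to extract their `(p, q)` components. -/
noncomputable def samplePoint (j : ℕ) : ℂ := 1 + j * Complex.I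

theorem conj_samplePoint_ne_zero (j : ℕ) : starRingEnd ℂ (samplePoint j) ≠ 0 := by
  intro h
  simpa [samplePoint] using congrArg Complex.re h

theorem samplePoint_div_conj_injective :
    Function.Injective fun j : ℕ => samplePoint j / starRingEnd ℂ (samplePoint j) := by
  intro j l h
  have h := (div_eq_div_iff (conj_samplePoint_ne_zero j) (conj_samplePoint_ne_zero l)).1 h
  have := congrArg Complex.im h
  simp [samplePoint] at this
  exact_mod_cast (by linarith : (j : ℝ) = l)

/-- Since s^p s̄^(k-p) = s̄^k (s/s̄)^p, sampling is a Vandermonde matrix in the ratios s/s̄ with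
rows rescaled by s̄^k. The ratios at the sample points are distinct, so it is invertible. -/
theorem exists_typeCoeff (k : ℕ) : ∃ c : Fin (k + 1) → Fin (k + 1) → ℂ,
    ∀ p p' : Fin (k + 1), ∑ j, c p j *
      (samplePoint j ^ (p' : ℕ) * (starRingEnd ℂ (samplePoint j)) ^ (k - p')) =
        if p = p' then 1 else 0 := by
  set w : Fin (k + 1) → ℂ := fun j => samplePoint j / starRingEnd ℂ (samplePoint j) with hw
  have hdet : IsUnit (Matrix.vandermonde w).det := by
    rw [isUnit_iff_ne_zero, Matrix.det_vandermonde_ne_zero_iff]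
    exact fun i j h => Fin.ext (samplePoint_div_conj_injective h)
  refine ⟨fun p j => (Matrix.vandermonde w)⁻¹ p j / (starRingEnd ℂ (samplePoint j)) ^ k,
    fun p p' => ?_⟩
  have h := congrFun (congrFun (Matrix.nonsing_inv_mul _ hdet) p) p'
  rw [Matrix.mul_apply, Matrix.one_apply] at h
  rw [← h]
  refine Finset.sum_congr rfl fun j _ => ?_
  have h0 := conj_samplePoint_ne_zero j
  have hk : (starRingEnd ℂ (samplePoint j)) ^ k =
      (starRingEnd ℂ (samplePoint j)) ^ (k - p' : ℕ) * (starRingEnd ℂ (samplePoint j)) ^ (p' : ℕ) := by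
    rw [← pow_add, Nat.sub_add_cancel (Nat.lt_succ_iff.1 p'.2)]
  simp only [Matrix.vandermonde_apply, hw, div_pow]
  rw [hk]
  field_simp

/-- The coefficients of the projection to the component of type `(p, k - p)`, as a combination
of rescalings of the arguments by the sample points. -/
noncomputable def typeCoeff (k : ℕ) : Fin (k + 1) → Fin (k + 1) → ℂ := (exists_typeCoeff k).choose

theorem sum_typeCoeff (k : ℕ) (p p' : Fin (k + 1)) : ∑ j, typeCoeff k p j *
    (samplePoint j ^ (p' : ℕ) * (starRingEnd ℂ (samplePoint j)) ^ (k - p')) =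
      if p = p' then 1 else 0 :=
  (exists_typeCoeff k).choose_spec p p'

end Coefficients

/-! ### Rescaling operators, the relations between ∂ and ∂̄, and type projections -/

section Manifold

variable {E : Type*} [NormedAddCommGroup E] [NormedSpace ℂ E]
  {X : Type*} [TopologicalSpace X] [ChartedSpace E X] [IsManifold 𝓘(ℂ, E) ω X]

/-- Transition maps are holomorphic; this is what makes rescaling compatible with changes of chart.
-/
theorem fderiv_transition_smul (c c' : atlas E X) {z : E}
    (hz : z ∈ (transition E X c c').source) (s : ℂ) (v : E) :
    fderiv ℝ (transition E X c c') z (s • v) = s • fderiv ℝ (transition E X c c') z v := by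
  rw [((transition_contDiffAt c c' hz).differentiableAt (by simp)).fderiv_restrictScalars ℝ]
  simp

/-- The operator on forms that multiplies all the arguments by `s`. It acts on forms of type
`(p, q)` as multiplication by `s ^ p * conj s ^ q`. -/
noncomputable def scale (s : ℂ) (k : ℕ) : Form E X k →ₗ[ℂ] Form E X k where
  toFun u := ⟨fun c z => (u.1 c z).compContinuousLinearMap (cplxScale E s), by
    refine ⟨fun c => ?_, fun c c' z hz => ?_, fun c z hz => ?_⟩
    · exact (ContinuousAlternatingMap.compContinuousLinearMapCLM
        (cplxScale E s) : Covector E k →L[ℝ] Covector E k).contDiff.comp_contDiffOn (u.2.1 c)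
    · ext v
      simp only [u.2.2.1 c c' z hz, ContinuousAlternatingMap.compContinuousLinearMap_apply]
      congr 1
      ext i
      exact fderiv_transition_smul c c' hz s (v i)
    · simp only [u.2.2.2 c z hz]
      ext v
      rfl⟩
  map_add' u v := by
    apply Form.ext_target
    intro c z hz
    ext v
    rfl
  map_smul' t u := by
    apply Form.ext_target
    intro c z hz
    ext v
    rfl

theorem scale_val (s : ℂ) {k : ℕ} (u : Form E X k) (c : atlas E X) (z : E) :
    (scale s k u).1 c z = (u.1 c z).compContinuousLinearMap (cplxScale E s) := rfl

theorem scale_val_apply (s : ℂ) {k : ℕ} (u : Form E X k) (c : atlas E X) (z : E)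
    (v : Fin k → E) : (scale s k u).1 c z v = u.1 c z (fun i => s • v i) := rfl

omit [IsManifold 𝓘(ℂ, E) ω X] in
theorem Form.ext_apply {k : ℕ} {u v : Form E X k}
    (h : ∀ (c : atlas E X), ∀ z ∈ c.1.target, ∀ w, u.1 c z w = v.1 c z w) : u = v :=
  Form.ext_target fun c z hz => ContinuousAlternatingMap.ext (h c z hz)

theorem scale_scale (s t : ℂ) {k : ℕ} (u : Form E X k) :
    scale s k (scale t k u) = scale (t * s) k u := by
  refine Form.ext_apply fun c z _ v => ?_
  simp only [scale_val_apply, mul_smul]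

theorem scale_injective {s : ℂ} (hs : s ≠ 0) (k : ℕ) :
    Function.Injective (scale s k : Form E X k →ₗ[ℂ] Form E X k) := by
  refine Function.LeftInverse.injective (g := scale s⁻¹ k) fun u => ?_
  rw [scale_scale, mul_inv_cancel₀ hs]
  refine Form.ext_apply fun c z _ v => ?_
  simp only [scale_val_apply, one_smul]

theorem mem_FormType_iff {k p q : ℕ} {u : Form E X k} :
    u ∈ FormType E X k p q ↔ ∀ s, scale s k u = (s ^ p * (starRingEnd ℂ s) ^ q) • u := by
  constructor
  · intro h s
    exact Form.ext_apply fun c z hz v => h c z hz s v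
  · intro h c z _ s v
    exact congrArg (fun w : Form E X k => w.1 c z v) (h s)

theorem scale_chartOp {a b s t : ℂ} (ha : a * s.re - b * s.im = t * a)
    (hb : a * s.im + b * s.re = t * b) {k : ℕ} (u : Form E X k) :
    scale s (k + 1) (chartOp a b k u) = t • chartOp a b k (scale s k u) := by
  refine Form.ext_target fun c z hz => ?_
  rw [scale_val, chartOp_mem _ _ _ _ hz, localOp_scale ha hb (u.differentiableAt c hz),
    Form.smul_val, Pi.smul_apply, Pi.smul_apply, chartOp_mem _ _ _ _ hz]
  rfl

theorem scale_del (s : ℂ) {k : ℕ} (u : Form E X k) :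
    scale s (k + 1) (del E X k u) = s • del E X k (scale s k u) := by
  refine scale_chartOp ?_ ?_ u
  · linear_combination (1 / 2 : ℂ) * Complex.re_add_im s
  · linear_combination (-(Complex.I / 2)) * Complex.re_add_im s + s.im / 2 * Complex.I_sq

theorem scale_delbar (s : ℂ) {k : ℕ} (u : Form E X k) :
    scale s (k + 1) (delbar E X k u) = starRingEnd ℂ s • delbar E X k (scale s k u) := by
  have hs : (s.re : ℂ) - s.im * Complex.I = starRingEnd ℂ s := by
    apply Complex.ext <;> simp
  refine scale_chartOp ?_ ?_ u
  · linear_combination (1 / 2 : ℂ) * hs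
  · linear_combination (Complex.I / 2) * hs + s.im / 2 * Complex.I_sq

theorem del_mem_FormType {k p q : ℕ} {u : Form E X k} (hu : u ∈ FormType E X k p q) :
    del E X k u ∈ FormType E X (k + 1) (p + 1) q := by
  rw [mem_FormType_iff] at hu ⊢
  intro s
  rw [scale_del, hu, map_smul, smul_smul]
  congr 1
  ring

theorem delbar_mem_FormType {k p q : ℕ} {u : Form E X k} (hu : u ∈ FormType E X k p q) :
    delbar E X k u ∈ FormType E X (k + 1) p (q + 1) := by
  rw [mem_FormType_iff] at hu ⊢
  intro s
  rw [scale_delbar, hu, map_smul, smul_smul]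
  congr 1
  ring

theorem d_d (k : ℕ) (u : Form E X k) : d E X (k + 1) (d E X k u) = 0 := by
  refine Form.ext_target fun c z hz => ?_
  have hev : (d E X k u).1 c =ᶠ[nhds z] extDeriv (u.1 c) := by
    filter_upwards [c.1.open_target.mem_nhds hz] with y hy
    exact d_apply u c hy
  rw [d_apply _ c hz, hev.extDeriv_eq]
  exact extDeriv_extDeriv_apply ((u.2.1 c).contDiffAt (c.1.open_target.mem_nhds hz))
    (by simp; exact WithTop.coe_le_coe.2 le_top)

/-- Applying d² = 0 to every rescaling of u gives a quadratic identity in s and s̄ whose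
coefficients are ∂²u, ∂̄²u and (∂∂̄ + ∂̄∂)u; enough values of s force each to vanish. -/
theorem del_delbar_relations (k : ℕ) (u : Form E X k) :
    del E X (k + 1) (del E X k u) = 0 ∧ delbar E X (k + 1) (delbar E X k u) = 0 ∧
      delbar E X (k + 1) (del E X k u) = -del E X (k + 1) (delbar E X k u) := by
  set A := del E X (k + 1) (del E X k u) with hA
  set B := delbar E X (k + 1) (delbar E X k u) with hB
  set C := del E X (k + 1) (delbar E X k u) + delbar E X (k + 1) (del E X k u) with hC
  have key : ∀ s : ℂ, s ≠ 0 →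
      (starRingEnd ℂ s) ^ 2 • A + (s * starRingEnd ℂ s) • C + s ^ 2 • B = 0 := by
    intro s hs
    have h := d_d k (scale s k u)
    have hs' : starRingEnd ℂ s ≠ 0 := by simpa using hs
    have e1 : del E X k (scale s k u) = s⁻¹ • scale s (k + 1) (del E X k u) := by
      rw [scale_del, inv_smul_smul₀ hs]
    have e2 : delbar E X k (scale s k u) =
        (starRingEnd ℂ s)⁻¹ • scale s (k + 1) (delbar E X k u) := by
      rw [scale_delbar, inv_smul_smul₀ hs']
    have f1 : ∀ w : Form E X (k + 1), del E X (k + 1) (scale s (k + 1) w) =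
        s⁻¹ • scale s (k + 2) (del E X (k + 1) w) := fun w => by
      rw [scale_del, inv_smul_smul₀ hs]
    have f2 : ∀ w : Form E X (k + 1), delbar E X (k + 1) (scale s (k + 1) w) =
        (starRingEnd ℂ s)⁻¹ • scale s (k + 2) (delbar E X (k + 1) w) := fun w => by
      rw [scale_delbar, inv_smul_smul₀ hs']
    simp only [d_eq_del_add_delbar, LinearMap.add_apply, e1, e2, map_add, map_smul, f1, f2] at h
    apply scale_injective hs (k + 2)
    rw [map_zero]
    simp only [hA, hB, hC, map_add, map_smul]
    have h2 := congrArg (fun w => (s ^ 2 * (starRingEnd ℂ s) ^ 2) • w) h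
    rw [smul_zero] at h2
    rw [← h2]
    match_scalars <;> field_simp
  -- The values 1, i and 1 + i give A + C + B = 0, -A + C - B = 0 and -2iA + 2C + 2iB = 0, an
  -- invertible system.
  have k1 := key 1 one_ne_zero
  have k2 := key Complex.I Complex.I_ne_zero
  have k3 := key (1 + Complex.I) fun h => by simpa using congrArg Complex.re h
  simp only [map_one, one_pow, one_mul, one_smul] at k1
  have i2 : (1 + Complex.I) ^ 2 = 2 * Complex.I := by
    linear_combination Complex.I_sq
  have i3 : (1 + -Complex.I) ^ 2 = -(2 * Complex.I) := by
    linear_combination Complex.I_sq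
  have i4 : (1 + Complex.I) * (1 + -Complex.I) = 2 := by
    linear_combination -Complex.I_sq
  simp only [Complex.conj_I, neg_sq, Complex.I_sq, mul_neg, Complex.I_mul_I,
    neg_neg, one_smul] at k2
  simp only [map_add, map_one, Complex.conj_I, i2, i3, i4] at k3
  have hC0 : C = 0 := by
    linear_combination (norm := module) (1 / 2 : ℂ) • k1 + (1 / 2 : ℂ) • k2
  have hAB : A = 0 ∧ B = 0 := by
    rw [hC0] at k1 k3
    have hAB : B = -A := by
      linear_combination (norm := module) k1
    rw [hAB] at k3
    have hA0 : A = 0 := by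
      have h4 : (-(4 * Complex.I)) • A = 0 := by
        linear_combination (norm := module) k3
      exact (smul_eq_zero.1 h4).resolve_left (by simp)
    exact ⟨hA0, by rw [hAB, hA0, neg_zero]⟩
  exact ⟨hAB.1, hAB.2, (neg_eq_of_add_eq_zero_right hC0).symm⟩

omit [IsManifold 𝓘(ℂ, E) ω X] in
theorem Form.eq_zero_of_finrank_lt [FiniteDimensional ℂ E] {k : ℕ}
    (hk : 2 * Module.finrank ℂ E < k) (u : Form E X k) : u = 0 := by
  refine Form.ext_apply fun c z _ v => ?_
  have : FiniteDimensional ℝ E := FiniteDimensional.complexToReal E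
  refine (u.1 c z).toAlternatingMap.map_linearDependent v fun h => ?_
  have := h.fintype_card_le_finrank
  rw [finrank_real_of_complex, Fintype.card_fin] at this
  omega

/-- The component of type `(p, k - p)` of a `k`-form. -/
noncomputable def typeProj (k : ℕ) (p : Fin (k + 1)) : Form E X k →ₗ[ℂ] Form E X k :=
  ∑ j, typeCoeff k p j • scale (samplePoint j) k

theorem typeProj_apply {k : ℕ} (p : Fin (k + 1)) (u : Form E X k) :
    typeProj k p u = ∑ j, typeCoeff k p j • scale (samplePoint j) k u := by
  simp [typeProj]

omit [IsManifold 𝓘(ℂ, E) ω X] in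
theorem Form.sum_val_apply {ι : Type*} (t : Finset ι) {k : ℕ} (u : ι → Form E X k)
    (c : atlas E X) (z : E) (v : Fin k → E) :
    (∑ i ∈ t, u i).1 c z v = ∑ i ∈ t, (u i).1 c z v := by
  classical
  induction t using Finset.induction_on with
  | empty => rfl
  | insert i t hi ih =>
    rw [Finset.sum_insert hi, Finset.sum_insert hi, ← ih]
    rfl

/-- The projection extracts one monomial from the expansion of u(s v). Keeping s free shows that the
result has the right type; s = 1 shows that the components sum to u. -/
theorem exists_typeProj_expansion {k : ℕ} (u : Form E X k) (c : atlas E X) (z : E)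
    (v : Fin k → E) : ∃ a : Fin (k + 1) → ℂ,
      (∀ s : ℂ, u.1 c z (fun i => s • v i) =
        ∑ p : Fin (k + 1), s ^ (p : ℕ) * (starRingEnd ℂ s) ^ (k - p) * a p) ∧
      ∀ (p : Fin (k + 1)) (s : ℂ), (typeProj k p u).1 c z (fun i => s • v i) =
        s ^ (p : ℕ) * (starRingEnd ℂ s) ^ (k - p) * a p := by
  obtain ⟨a, ha⟩ := exists_scale_expansion (u.1 c z).toMultilinearMap v
  have ha' : ∀ s : ℂ, u.1 c z (fun i => s • v i) =
      ∑ p : Fin (k + 1), s ^ (p : ℕ) * (starRingEnd ℂ s) ^ (k - p) * a p := fun s =>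
    (ha s).trans (Finset.sum_range fun p => s ^ p * (starRingEnd ℂ s) ^ (k - p) * a p)
  refine ⟨fun p => a p, ha', fun p s => ?_⟩
  have h1 : ∀ j : Fin (k + 1),
      (typeCoeff k p j • scale (samplePoint j) k u).1 c z (fun i => s • v i) =
      ∑ p' : Fin (k + 1), (typeCoeff k p j *
        (samplePoint j ^ (p' : ℕ) * (starRingEnd ℂ (samplePoint j)) ^ (k - p'))) *
        (s ^ (p' : ℕ) * (starRingEnd ℂ s) ^ (k - p') * a p') := by
    intro j
    -- Rescalings compose, so the s-monomials factor out of the sampled ones and `sum_typeCoeff`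
    -- applies.
    have h2 := ha' (samplePoint j * s)
    simp only [mul_smul] at h2
    change typeCoeff k p j * u.1 c z (fun i => samplePoint j • s • v i) = _
    rw [h2, Finset.mul_sum]
    refine Finset.sum_congr rfl fun p' _ => ?_
    rw [map_mul]
    ring
  rw [typeProj_apply, Form.sum_val_apply, Finset.sum_congr rfl fun j _ => h1 j,
    Finset.sum_comm]
  simp_rw [← Finset.sum_mul, sum_typeCoeff]
  simp

theorem typeProj_mem {k : ℕ} (p : Fin (k + 1)) (u : Form E X k) :
    typeProj k p u ∈ FormType E X k p (k - p) := by
  intro c z _ s v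
  obtain ⟨a, -, ha⟩ := exists_typeProj_expansion u c z v
  have h1 := ha p 1
  simp only [one_smul, one_pow, map_one, one_mul] at h1
  rw [ha, h1]

theorem sum_typeProj {k : ℕ} (u : Form E X k) : ∑ p, typeProj k p u = u := by
  refine Form.ext_apply fun c z _ v => ?_
  obtain ⟨a, hu, ha⟩ := exists_typeProj_expansion u c z v
  have h0 := hu 1
  have h1 := fun p => ha p 1
  simp only [one_smul, one_pow, map_one, one_mul] at h0 h1
  rw [Form.sum_val_apply, h0]
  exact Finset.sum_congr rfl fun p _ => h1 p

theorem typeProj_of_mem {k q : ℕ} (p p' : Fin (k + 1)) (hq : p' + q = k) {u : Form E X k}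
    (hu : u ∈ FormType E X k p' q) : typeProj k p u = if p = p' then u else 0 := by
  obtain rfl : q = k - p' := by omega
  rw [typeProj_apply, Finset.sum_congr rfl fun j _ => by
    rw [mem_FormType_iff.1 hu (samplePoint j), smul_smul], ← Finset.sum_smul, sum_typeCoeff,
    ite_smul, one_smul, zero_smul]

theorem typeProj_self {k p q : ℕ} (hq : p + q = k) {u : Form E X k}
    (hu : u ∈ FormType E X k p q) (hp : p < k + 1) : typeProj k ⟨p, hp⟩ u = u := by
  rw [typeProj_of_mem ⟨p, hp⟩ ⟨p, hp⟩ hq hu, if_pos rfl]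

/-- ∂ raises the first index by one, so of the components of u only the one of index p contributes.
Likewise ∂ reaches no form of index 0, while ∂̄ keeps the first index and so misses the last one. -/
theorem typeProj_succ_del {k : ℕ} (p : Fin (k + 1)) (u : Form E X k) :
    typeProj (k + 1) p.succ (del E X k u) = del E X k (typeProj k p u) := by
  conv_lhs => rw [← sum_typeProj u, map_sum, map_sum]
  rw [Finset.sum_eq_single p, typeProj_of_mem p.succ p.succ (q := k - p) (by simp; omega)
    (del_mem_FormType (typeProj_mem p u)), if_pos rfl]
  · intro j _ hj
    rw [typeProj_of_mem p.succ j.succ (q := k - j) (by simp; omega)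
      (del_mem_FormType (typeProj_mem j u)), if_neg]
    exact fun h => hj (Fin.succ_injective _ h).symm
  · exact fun h => absurd (Finset.mem_univ p) h

theorem typeProj_zero_del {k : ℕ} (u : Form E X k) :
    typeProj (k + 1) 0 (del E X k u) = 0 := by
  rw [← sum_typeProj u, map_sum, map_sum]
  refine Finset.sum_eq_zero fun j _ => ?_
  rw [typeProj_of_mem 0 j.succ (q := k - j) (by simp; omega)
    (del_mem_FormType (typeProj_mem j u)), if_neg (Fin.succ_ne_zero j).symm]

theorem typeProj_castSucc_delbar {k : ℕ} (p : Fin (k + 1)) (u : Form E X k) :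
    typeProj (k + 1) p.castSucc (delbar E X k u) = delbar E X k (typeProj k p u) := by
  conv_lhs => rw [← sum_typeProj u, map_sum, map_sum]
  rw [Finset.sum_eq_single p, typeProj_of_mem p.castSucc p.castSucc (q := k - p + 1)
    (by simp; omega) (delbar_mem_FormType (typeProj_mem p u)), if_pos rfl]
  · intro j _ hj
    rw [typeProj_of_mem p.castSucc j.castSucc (q := k - j + 1) (by simp; omega)
      (delbar_mem_FormType (typeProj_mem j u)), if_neg]
    exact fun h => hj (Fin.castSucc_injective _ h).symm
  · exact fun h => absurd (Finset.mem_univ p) h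

theorem typeProj_last_delbar {k : ℕ} (u : Form E X k) :
    typeProj (k + 1) (Fin.last (k + 1)) (delbar E X k u) = 0 := by
  rw [← sum_typeProj u, map_sum, map_sum]
  refine Finset.sum_eq_zero fun j _ => ?_
  rw [typeProj_of_mem (Fin.last (k + 1)) j.castSucc (q := k - j + 1) (by simp; omega)
    (delbar_mem_FormType (typeProj_mem j u)), if_neg (Fin.castSucc_lt_last j).ne']

end Manifold

/-! ### Canonical maps between subquotients -/

section Subquotient

variable {V : Type*} [AddCommGroup V] [Module ℂ V]

theorem cls_surjective {Z B : Submodule ℂ V} (x : Subquotient Z B) :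
    ∃ (α : V) (hα : α ∈ Z), cls Z B hα = x := by
  obtain ⟨⟨α, hα⟩, h⟩ := (B.submoduleOf Z).mkQ_surjective x
  exact ⟨α, hα, h⟩

theorem cls_eq_cls_iff {Z B : Submodule ℂ V} {α β : V} (hα : α ∈ Z) (hβ : β ∈ Z) :
    cls Z B hα = cls Z B hβ ↔ α - β ∈ B :=
  Submodule.Quotient.eq (B.submoduleOf Z)

theorem cls_eq_zero_iff {Z B : Submodule ℂ V} {α : V} (hα : α ∈ Z) :
    cls Z B hα = 0 ↔ α ∈ B :=
  Submodule.Quotient.mk_eq_zero (B.submoduleOf Z)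

/-- The map `Z / B → Z' / B'` induced by an endomorphism `f` of the ambient space. -/
noncomputable def Subquotient.map {Z B Z' B' : Submodule ℂ V} (f : V →ₗ[ℂ] V)
    (hZ : ∀ α ∈ Z, f α ∈ Z')
    (hB : ∀ α ∈ B, f α ∈ B') : Subquotient Z B →ₗ[ℂ] Subquotient Z' B' :=
  Submodule.mapQ (B.submoduleOf Z) (B'.submoduleOf Z') (f.restrict hZ) fun α hα => hB α.1 hα

/-- The canonical map `Z / B → Z' / B'` for `Z ≤ Z'` and `B ≤ B'`. -/
noncomputable def canonicalMap {Z B Z' B' : Submodule ℂ V} (hZ : Z ≤ Z') (hB : B ≤ B') :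
    Subquotient Z B →ₗ[ℂ] Subquotient Z' B' :=
  Subquotient.map LinearMap.id hZ hB

theorem isCanonical_canonicalMap {Z B Z' B' : Submodule ℂ V} (hZ : Z ≤ Z') (hB : B ≤ B') :
    IsCanonical (canonicalMap hZ hB) :=
  fun _ hα => ⟨hZ hα, rfl⟩

theorem IsCanonical.comp {Z B Z' B' Z'' B'' : Submodule ℂ V}
    {R : Subquotient Z' B' →ₗ[ℂ] Subquotient Z'' B''} {S : Subquotient Z B →ₗ[ℂ] Subquotient Z' B'}
    (hR : IsCanonical R) (hS : IsCanonical S) : IsCanonical (R ∘ₗ S) := by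
  intro α hα
  obtain ⟨h', e'⟩ := hS α hα
  obtain ⟨h'', e''⟩ := hR α h'
  exact ⟨h'', by rw [LinearMap.comp_apply, e', e'']⟩

/-- The kernel of [α] ↦ [α] is (Z ∩ B')/B and its cokernel is Z'/(Z + B'); the two hypotheses make
them vanish. -/
theorem IsCanonical.bijective {Z B Z' B' : Submodule ℂ V}
    {T : Subquotient Z B →ₗ[ℂ] Subquotient Z' B'} (hT : IsCanonical T)
    (hinj : ∀ α ∈ Z, α ∈ B' → α ∈ B) (hsurj : ∀ α ∈ Z', ∃ γ ∈ B', α - γ ∈ Z) :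
    Function.Bijective T := by
  constructor
  · rw [injective_iff_map_eq_zero]
    intro x hx
    obtain ⟨α, hα, rfl⟩ := cls_surjective x
    obtain ⟨h', e⟩ := hT α hα
    rw [e, cls_eq_zero_iff] at hx
    exact (cls_eq_zero_iff hα).2 (hinj α hα hx)
  · intro y
    obtain ⟨α, hα, rfl⟩ := cls_surjective y
    obtain ⟨γ, hγ, h⟩ := hsurj α hα
    obtain ⟨h', e⟩ := hT _ h
    refine ⟨cls Z B h, e.trans ?_⟩
    rw [cls_eq_cls_iff, sub_sub_cancel_left]
    exact neg_mem hγ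

/-- If projections `π i` with sum `1` decompose `Z` and `B` into pieces `Z i` and `B i`, then
`Z / B` is canonically the direct sum of the `Z i / B i`. -/
theorem exists_directSum_equiv {ι : Type*} [Fintype ι] [DecidableEq ι] {Z B : Submodule ℂ V}
    {Zi Bi : ι → Submodule ℂ V} (π : ι → V →ₗ[ℂ] V)
    (hZi : ∀ i, Zi i ≤ Z) (hBi : ∀ i, Bi i ≤ B)
    (hZ : ∀ i, ∀ α ∈ Z, π i α ∈ Zi i) (hB : ∀ i, ∀ α ∈ B, π i α ∈ Bi i)
    (hsum : ∀ α ∈ Z, ∑ i, π i α = α)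
    (hself : ∀ i, ∀ α ∈ Zi i, π i α = α) (hne : ∀ i j, i ≠ j → ∀ α ∈ Zi j, π i α = 0) :
    ∃ Φ : (DirectSum ι fun i => Subquotient (Zi i) (Bi i)) ≃ₗ[ℂ] Subquotient Z B,
      ∀ i, IsCanonical (Φ.toLinearMap ∘ₗ
        DirectSum.lof ℂ ι (fun i => Subquotient (Zi i) (Bi i)) i) := by
  set F : (DirectSum ι fun i => Subquotient (Zi i) (Bi i)) →ₗ[ℂ] Subquotient Z B :=
    DirectSum.toModule ℂ ι _ fun i => canonicalMap (hZi i) (hBi i) with hF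
  have hFlof : ∀ i x, F (DirectSum.lof ℂ ι _ i x) = canonicalMap (hZi i) (hBi i) x :=
    fun i x => DirectSum.toModule_lof ℂ
      (φ := fun i => canonicalMap (hZi i) (hBi i)) i x
  -- The maps induced by the projections recover every coordinate from the image under `F`; this
  -- gives injectivity.
  have hcomp : ∀ i, Subquotient.map (π i) (hZ i) (hB i) ∘ₗ F =
      DirectSum.component ℂ ι (fun i => Subquotient (Zi i) (Bi i)) i := by
    intro i
    refine DirectSum.linearMap_ext ℂ fun j => ?_
    refine LinearMap.ext fun x => ?_
    obtain ⟨α, hα, rfl⟩ := cls_surjective x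
    have e : (Subquotient.map (π i) (hZ i) (hB i) ∘ₗ F) (DirectSum.lof ℂ ι _ j (cls _ _ hα)) =
        cls (Zi i) (Bi i) (hZ i α (hZi j hα)) := by
      rw [LinearMap.comp_apply, hFlof]
      rfl
    refine e.trans ?_
    rw [LinearMap.comp_apply]
    by_cases hij : i = j
    · subst hij
      rw [DirectSum.component.lof_self, cls_eq_cls_iff, hself i α hα, sub_self]
      exact zero_mem _
    · rw [DirectSum.component.of, dif_neg (Ne.symm hij), cls_eq_zero_iff, hne i j hij α hα]
      exact zero_mem _
  have hbij : Function.Bijective F := by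
    constructor
    · rw [injective_iff_map_eq_zero]
      intro x hx
      refine DirectSum.ext_component ℂ fun i => ?_
      rw [← hcomp i, LinearMap.comp_apply, hx, map_zero, map_zero]
    · intro y
      obtain ⟨α, hα, rfl⟩ := cls_surjective y
      refine ⟨∑ i, DirectSum.lof ℂ ι _ i (cls (Zi i) (Bi i) (hZ i α hα)), ?_⟩
      rw [map_sum]
      have : ∀ i, F (DirectSum.lof ℂ ι _ i (cls (Zi i) (Bi i) (hZ i α hα))) =
          (B.submoduleOf Z).mkQ ⟨π i α, hZi i (hZ i α hα)⟩ := fun i => hFlof i _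
      refine (Finset.sum_congr rfl fun i _ => this i).trans
        ((map_sum (B.submoduleOf Z).mkQ _ _).symm.trans ?_)
      refine congrArg (B.submoduleOf Z).mkQ (Subtype.ext ?_)
      rw [AddSubmonoidClass.coe_finsetSum]
      exact hsum α hα
  refine ⟨LinearEquiv.ofBijective F hbij, fun i α hα => ⟨hZi i hα, ?_⟩⟩
  exact hFlof i _

end Subquotient

/-! ### Replacing d_h and d_{-1/h} by ∂ and ∂̄ -/

section Manifold

variable {E : Type*} [NormedAddCommGroup E] [NormedSpace ℂ E]
  {X : Type*} [TopologicalSpace X] [ChartedSpace E X] [IsManifold 𝓘(ℂ, E) ω X]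

theorem del_del (k : ℕ) (u : Form E X k) : del E X (k + 1) (del E X k u) = 0 :=
  (del_delbar_relations k u).1

theorem delbar_delbar (k : ℕ) (u : Form E X k) : delbar E X (k + 1) (delbar E X k u) = 0 :=
  (del_delbar_relations k u).2.1

theorem delbar_del (k : ℕ) (u : Form E X k) :
    delbar E X (k + 1) (del E X k u) = -del E X (k + 1) (delbar E X k u) :=
  (del_delbar_relations k u).2.2

theorem dh_apply (h : ℝ) (k : ℕ) (u : Form E X k) :
    dh E X h k u = (h : ℂ) • del E X k u + delbar E X k u := rfl

/-- The squares drop out and ∂̄∂ = -∂∂̄. Both d_h² = 0 and the anticommutation of d_h with d_{h'}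
follow. -/
theorem dh_dh (h h' : ℝ) (k : ℕ) (u : Form E X k) :
    dh E X h (k + 1) (dh E X h' k u) =
      ((h : ℂ) - h') • del E X (k + 1) (delbar E X k u) := by
  simp only [dh_apply, map_add, map_smul, del_del, delbar_delbar, delbar_del]
  module

/-- Equality would mean h² = -1. Being different from h is the only property of -1/h that the proof
needs. -/
theorem ne_neg_one_div {h : ℝ} (h0 : h ≠ 0) : h ≠ -(1 / h) := by
  intro e
  have : h * h = -1 := by
    nth_rewrite 2 [e]
    field_simp
  nlinarith [mul_self_nonneg h]

variable {h h' : ℝ}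

/-- Together with `delbar_eq_smul_dh`, this inverts the 2 × 2 system expressing d_h and d_{h'}
through ∂ and ∂̄. -/
theorem del_eq_smul_dh (hne : h ≠ h') (k : ℕ) (u : Form E X k) :
    del E X k u = ((h : ℂ) - h')⁻¹ • (dh E X h k u - dh E X h' k u) := by
  have : (h : ℂ) - h' ≠ 0 := sub_ne_zero.2 (Complex.ofReal_injective.ne hne)
  rw [dh_apply, dh_apply, eq_inv_smul_iff₀ this]
  module

theorem delbar_eq_smul_dh (hne : h ≠ h') (k : ℕ) (u : Form E X k) :
    delbar E X k u = ((h : ℂ) - h')⁻¹ • ((h : ℂ) • dh E X h' k u - (h' : ℂ) • dh E X h k u) := by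
  have : (h : ℂ) - h' ≠ 0 := sub_ne_zero.2 (Complex.ofReal_injective.ne hne)
  rw [dh_apply, dh_apply, eq_inv_smul_iff₀ this]
  module

theorem ker_dh_inf_ker_dh (hne : h ≠ h') (k : ℕ) :
    LinearMap.ker (dh E X h k) ⊓ LinearMap.ker (dh E X h' k) =
      LinearMap.ker (del E X k) ⊓ LinearMap.ker (delbar E X k) := by
  ext u
  simp only [Submodule.mem_inf, LinearMap.mem_ker]
  constructor
  · rintro ⟨h1, h2⟩
    rw [del_eq_smul_dh hne, delbar_eq_smul_dh hne, h1, h2]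
    simp
  · rintro ⟨h1, h2⟩
    simp [dh_apply, h1, h2]

theorem dh_comp_dh (h h' : ℝ) (k : ℕ) :
    dh E X h (k + 1) ∘ₗ dh E X h' k =
      ((h : ℂ) - h') • (del E X (k + 1) ∘ₗ delbar E X k) :=
  LinearMap.ext fun u => dh_dh h h' k u

theorem ker_dh_comp_dh (hne : h ≠ h') (k : ℕ) :
    LinearMap.ker (dh E X h (k + 1) ∘ₗ dh E X h' k) =
      LinearMap.ker (del E X (k + 1) ∘ₗ delbar E X k) := by
  rw [dh_comp_dh, LinearMap.ker_smul _ _ (sub_ne_zero.2 (Complex.ofReal_injective.ne hne))]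

theorem imOfComp_dh_dh (hne : h ≠ h') (k : ℕ) :
    imOfComp E X (dh E X h) (dh E X h') k = imOfComp E X (del E X) (delbar E X) k := by
  match k with
  | 0 => rfl
  | 1 => rfl
  | k + 2 =>
    simp only [imOfComp]
    rw [dh_comp_dh, LinearMap.range_smul _ _ (sub_ne_zero.2 (Complex.ofReal_injective.ne hne))]

theorem imOf_dh_sup_imOf_dh (hne : h ≠ h') (k : ℕ) :
    imOf E X (dh E X h) k ⊔ imOf E X (dh E X h') k =
      imOf E X (del E X) k ⊔ imOf E X (delbar E X) k := by
  cases k with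
  | zero => rfl
  | succ k =>
    simp only [imOf]
    apply le_antisymm
    · refine sup_le ?_ ?_ <;>
      · rintro _ ⟨u, rfl⟩
        exact add_mem (Submodule.smul_mem _ _ (Submodule.mem_sup_left ⟨u, rfl⟩))
          (Submodule.mem_sup_right ⟨u, rfl⟩)
    · refine sup_le ?_ ?_
      · rintro _ ⟨u, rfl⟩
        rw [del_eq_smul_dh hne]
        exact Submodule.smul_mem _ _ (sub_mem (Submodule.mem_sup_left ⟨u, rfl⟩)
          (Submodule.mem_sup_right ⟨u, rfl⟩))
      · rintro _ ⟨u, rfl⟩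
        rw [delbar_eq_smul_dh hne]
        exact Submodule.smul_mem _ _ (sub_mem
          (Submodule.smul_mem _ _ (Submodule.mem_sup_right ⟨u, rfl⟩))
          (Submodule.smul_mem _ _ (Submodule.mem_sup_left ⟨u, rfl⟩)))

/-! ### Decomposition into types -/

theorem typeProj_mem_imDelType {k p q : ℕ} (hpq : p + q = k) (hp : p < k + 1) {α : Form E X k}
    (hα : α ∈ imOf E X (del E X) k) : typeProj k ⟨p, hp⟩ α ∈ imDelType E X k p q := by
  match k, p with
  | 0, _ =>
    rw [(Submodule.mem_bot ℂ).1 hα, map_zero]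
    exact zero_mem _
  | k + 1, 0 =>
    obtain ⟨β, rfl⟩ := hα
    have : typeProj (k + 1) ⟨0, hp⟩ (del E X k β) = 0 := typeProj_zero_del β
    rw [this]
    exact zero_mem _
  | k + 1, p + 1 =>
    obtain ⟨β, rfl⟩ := hα
    obtain rfl : q = k - p := by omega
    exact ⟨_, typeProj_mem ⟨p, by omega⟩ β, (typeProj_succ_del ⟨p, by omega⟩ β).symm⟩

theorem typeProj_mem_imDelbarType {k p q : ℕ} (hpq : p + q = k) (hp : p < k + 1)
    {α : Form E X k} (hα : α ∈ imOf E X (delbar E X) k) :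
    typeProj k ⟨p, hp⟩ α ∈ imDelbarType E X k p q := by
  match k, q with
  | 0, _ =>
    rw [(Submodule.mem_bot ℂ).1 hα, map_zero]
    exact zero_mem _
  | k + 1, 0 =>
    obtain ⟨β, rfl⟩ := hα
    obtain rfl : p = k + 1 := by omega
    have : typeProj (k + 1) ⟨k + 1, hp⟩ (delbar E X k β) = 0 := typeProj_last_delbar β
    rw [this]
    exact zero_mem _
  | k + 1, q + 1 =>
    obtain ⟨β, rfl⟩ := hα
    obtain rfl : q = k - p := by omega
    exact ⟨_, typeProj_mem ⟨p, by omega⟩ β, (typeProj_castSucc_delbar ⟨p, by omega⟩ β).symm⟩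

theorem typeProj_mem_imDelDelbarType {k p q : ℕ} (hpq : p + q = k) (hp : p < k + 1)
    {α : Form E X k} (hα : α ∈ imOfComp E X (del E X) (delbar E X) k) :
    typeProj k ⟨p, hp⟩ α ∈ imDelDelbarType E X k p q := by
  match k, p, q with
  | 0, _, _ =>
    rw [(Submodule.mem_bot ℂ).1 hα, map_zero]
    exact zero_mem _
  | 1, _, _ =>
    rw [(Submodule.mem_bot ℂ).1 hα, map_zero]
    exact zero_mem _
  | k + 2, 0, _ =>
    obtain ⟨β, rfl⟩ := hα
    have : typeProj (k + 2) ⟨0, hp⟩ (del E X (k + 1) (delbar E X k β)) = 0 :=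
      typeProj_zero_del _
    rw [LinearMap.comp_apply, this]
    exact zero_mem _
  | k + 2, p + 1, 0 =>
    obtain ⟨β, rfl⟩ := hα
    obtain rfl : p = k + 1 := by omega
    -- In type (k + 2, 0) the component vanishes because the form is also -∂̄∂β, and ∂̄ never lands
    -- there.
    have : typeProj (k + 2) ⟨k + 1 + 1, hp⟩ (delbar E X (k + 1) (del E X k β)) = 0 :=
      typeProj_last_delbar _
    rw [LinearMap.comp_apply, ← neg_eq_iff_eq_neg.2 (delbar_del k β), map_neg, this, neg_zero]
    exact zero_mem _
  | k + 2, p + 1, q + 1 =>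
    obtain ⟨β, rfl⟩ := hα
    obtain rfl : q = k - p := by omega
    refine ⟨_, typeProj_mem ⟨p, by omega⟩ β, ?_⟩
    have h1 := typeProj_succ_del ⟨p, by omega⟩ (delbar E X k β)
    have h2 := typeProj_castSucc_delbar ⟨p, by omega⟩ β
    rw [LinearMap.comp_apply, ← h2]
    exact h1.symm

theorem imDelType_le (k p q : ℕ) : imDelType E X k p q ≤ imOf E X (del E X) k := by
  match k, p with
  | 0, _ => exact bot_le
  | k + 1, 0 => exact bot_le
  | k + 1, p + 1 =>
    rintro _ ⟨β, -, rfl⟩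
    exact ⟨β, rfl⟩

theorem imDelbarType_le (k p q : ℕ) : imDelbarType E X k p q ≤ imOf E X (delbar E X) k := by
  match k, q with
  | 0, _ => exact bot_le
  | k + 1, 0 => exact bot_le
  | k + 1, q + 1 =>
    rintro _ ⟨β, -, rfl⟩
    exact ⟨β, rfl⟩

theorem imDelDelbarType_le (k p q : ℕ) :
    imDelDelbarType E X k p q ≤ imOfComp E X (del E X) (delbar E X) k := by
  match k, p, q with
  | 0, _, _ => exact bot_le
  | 1, _, _ => exact bot_le
  | k + 2, 0, _ => exact bot_le
  | k + 2, p + 1, 0 => exact bot_le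
  | k + 2, p + 1, q + 1 =>
    rintro _ ⟨β, -, rfl⟩
    exact ⟨β, rfl⟩

theorem del_typeProj_eq_zero {k : ℕ} (p : Fin (k + 1)) {α : Form E X k}
    (hα : del E X k α = 0) : del E X k (typeProj k p α) = 0 := by
  rw [← typeProj_succ_del, hα, map_zero]

theorem delbar_typeProj_eq_zero {k : ℕ} (p : Fin (k + 1)) {α : Form E X k}
    (hα : delbar E X k α = 0) : delbar E X k (typeProj k p α) = 0 := by
  rw [← typeProj_castSucc_delbar, hα, map_zero]

theorem del_delbar_typeProj_eq_zero {k : ℕ} (p : Fin (k + 1)) {α : Form E X k}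
    (hα : del E X (k + 1) (delbar E X k α) = 0) :
    del E X (k + 1) (delbar E X k (typeProj k p α)) = 0 := by
  rw [← typeProj_castSucc_delbar, ← typeProj_succ_del, hα, map_zero]

/-- The bidegrees `(p, q)` with `p + q = k` are determined by `p ≤ k`. -/
def bidegreeEquiv (k : ℕ) : {pq : ℕ × ℕ // pq.1 + pq.2 = k} ≃ Fin (k + 1) where
  toFun pq := ⟨pq.1.1, by have := pq.2; omega⟩
  invFun p := ⟨(p, k - p), by simp only; omega⟩
  left_inv pq := by
    have := pq.2
    refine Subtype.ext (Prod.ext rfl ?_)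
    simp only
    omega
  right_inv p := rfl

/-- A subquotient of the space of `k`-forms whose numerator and denominator are compatible with
the type decomposition is the direct sum of its components of the various types. -/
theorem exists_directSum_bidegree_equiv {k : ℕ} {Z B : Submodule ℂ (Form E X k)}
    {Zi Bi : ℕ × ℕ → Submodule ℂ (Form E X k)}
    (hZi : ∀ pq, Zi pq ≤ Z) (hBi : ∀ pq, Bi pq ≤ B)
    (hZt : ∀ pq, Zi pq ≤ FormType E X k pq.1 pq.2)
    (hZ : ∀ p q, p + q = k → ∀ hp, ∀ α ∈ Z, typeProj k ⟨p, hp⟩ α ∈ Zi (p, q))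
    (hB : ∀ p q, p + q = k → ∀ hp, ∀ α ∈ B, typeProj k ⟨p, hp⟩ α ∈ Bi (p, q)) :
    ∃ Φ : (DirectSum {pq : ℕ × ℕ // pq.1 + pq.2 = k} fun pq => Subquotient (Zi pq.1) (Bi pq.1))
        ≃ₗ[ℂ] Subquotient Z B,
      ∀ pq, IsCanonical (Φ.toLinearMap ∘ₗ DirectSum.lof ℂ {pq : ℕ × ℕ // pq.1 + pq.2 = k}
        (fun pq => Subquotient (Zi pq.1) (Bi pq.1)) pq) := by
  let _ : Fintype {pq : ℕ × ℕ // pq.1 + pq.2 = k} := Fintype.ofEquiv _ (bidegreeEquiv k).symm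
  refine exists_directSum_equiv (Zi := fun pq : {pq : ℕ × ℕ // pq.1 + pq.2 = k} => Zi pq.1)
    (Bi := fun pq => Bi pq.1) (fun pq => typeProj k (bidegreeEquiv k pq))
    (fun pq => hZi pq.1) (fun pq => hBi pq.1) (fun pq => hZ _ _ pq.2 _) (fun pq => hB _ _ pq.2 _)
    (fun α _ => ?_) (fun pq α hα => ?_) (fun pq pq' hne α hα => ?_)
  · rw [Equiv.sum_comp (bidegreeEquiv k) fun p => typeProj k p α, sum_typeProj]
  · exact typeProj_self pq.2 (hZt _ hα) _
  · rw [typeProj_of_mem (bidegreeEquiv k pq) (bidegreeEquiv k pq') pq'.2 (hZt _ hα), if_neg]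
    exact (bidegreeEquiv k).injective.ne hne

theorem typeProj_mem_of_add_eq {k p q : ℕ} (hpq : p + q = k) (hp : p < k + 1) (u : Form E X k) :
    typeProj k ⟨p, hp⟩ u ∈ FormType E X k p q := by
  obtain rfl : q = k - p := by omega
  exact typeProj_mem ⟨p, hp⟩ u

/-- Once everything is stated with ∂ and ∂̄, components of closed forms are closed and components of
∂∂̄-exact forms are ∂∂̄-exact. The left-hand side does not involve h. -/
theorem exists_directSum_HBC_equiv (h0 : h ≠ 0) (k : ℕ) :
    ∃ Φ : (DirectSum {pq : ℕ × ℕ // pq.1 + pq.2 = k} fun pq => HBC E X k pq.1.1 pq.1.2)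
        ≃ₗ[ℂ] HhBC E X h k,
      ∀ pq, IsCanonical (Φ.toLinearMap ∘ₗ DirectSum.lof ℂ {pq : ℕ × ℕ // pq.1 + pq.2 = k}
        (fun pq => HBC E X k pq.1.1 pq.1.2) pq) := by
  refine exists_directSum_bidegree_equiv
    (Zi := fun pq => FormType E X k pq.1 pq.2 ⊓ LinearMap.ker (del E X k) ⊓
      LinearMap.ker (delbar E X k)) (Bi := fun pq => imDelDelbarType E X k pq.1 pq.2)
    (fun pq => ?_) (fun pq => ?_) (fun pq => inf_le_left.trans inf_le_left)
    (fun p q hpq hp α hα => ?_) (fun p q hpq hp α hα => ?_)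
  · rw [ker_dh_inf_ker_dh (ne_neg_one_div h0)]
    exact inf_le_inf_right _ inf_le_right
  · rw [imOfComp_dh_dh (ne_neg_one_div h0)]
    exact imDelDelbarType_le k _ _
  · rw [ker_dh_inf_ker_dh (ne_neg_one_div h0)] at hα
    exact ⟨⟨typeProj_mem_of_add_eq hpq hp α, del_typeProj_eq_zero _ hα.1⟩,
      delbar_typeProj_eq_zero _ hα.2⟩
  · rw [imOfComp_dh_dh (ne_neg_one_div h0)] at hα
    exact typeProj_mem_imDelDelbarType hpq hp hα

theorem exists_directSum_HA_equiv (h0 : h ≠ 0) (k : ℕ) :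
    ∃ Ψ : (DirectSum {pq : ℕ × ℕ // pq.1 + pq.2 = k} fun pq => HA E X k pq.1.1 pq.1.2)
        ≃ₗ[ℂ] HhA E X h k,
      ∀ pq, IsCanonical (Ψ.toLinearMap ∘ₗ DirectSum.lof ℂ {pq : ℕ × ℕ // pq.1 + pq.2 = k}
        (fun pq => HA E X k pq.1.1 pq.1.2) pq) := by
  refine exists_directSum_bidegree_equiv
    (Zi := fun pq => FormType E X k pq.1 pq.2 ⊓
      LinearMap.ker (del E X (k + 1) ∘ₗ delbar E X k))
    (Bi := fun pq => imDelType E X k pq.1 pq.2 ⊔ imDelbarType E X k pq.1 pq.2)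
    (fun pq => ?_) (fun pq => ?_) (fun pq => inf_le_left)
    (fun p q hpq hp α hα => ?_) (fun p q hpq hp α hα => ?_)
  · rw [ker_dh_comp_dh (ne_neg_one_div h0)]
    exact inf_le_right
  · rw [imOf_dh_sup_imOf_dh (ne_neg_one_div h0)]
    exact sup_le_sup (imDelType_le k _ _) (imDelbarType_le k _ _)
  · rw [ker_dh_comp_dh (ne_neg_one_div h0)] at hα
    exact ⟨typeProj_mem_of_add_eq hpq hp α, del_delbar_typeProj_eq_zero _ hα⟩
  · rw [imOf_dh_sup_imOf_dh (ne_neg_one_div h0)] at hα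
    obtain ⟨β, hβ, γ, hγ, rfl⟩ := Submodule.mem_sup.1 hα
    rw [map_add]
    exact add_mem (Submodule.mem_sup_left (typeProj_mem_imDelType hpq hp hβ))
      (Submodule.mem_sup_right (typeProj_mem_imDelbarType hpq hp hγ))

end Manifold

/-! ### Consequences of the h-∂∂̄ property -/

section Manifold

variable {E : Type*} [NormedAddCommGroup E] [NormedSpace ℂ E]
  {X : Type*} [TopologicalSpace X] [ChartedSpace E X] [IsManifold 𝓘(ℂ, E) ω X] {h h' : ℝ}

theorem dh_dh_self (h : ℝ) (k : ℕ) (u : Form E X k) : dh E X h (k + 1) (dh E X h k u) = 0 := by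
  rw [dh_dh, sub_self, zero_smul]

theorem dh_dh_comm (h h' : ℝ) (k : ℕ) (u : Form E X k) :
    dh E X h (k + 1) (dh E X h' k u) = -dh E X h' (k + 1) (dh E X h k u) := by
  rw [dh_dh, dh_dh, ← neg_smul, neg_sub]

theorem dh_eq_zero_of_mem_imOf {k : ℕ} {u : Form E X k} (hu : u ∈ imOf E X (dh E X h) k) :
    dh E X h k u = 0 := by
  cases k with
  | zero => rw [(Submodule.mem_bot ℂ).1 hu, map_zero]
  | succ k =>
    obtain ⟨β, rfl⟩ := hu
    exact dh_dh_self h k β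

theorem imOfComp_le_imOf (h h' : ℝ) (k : ℕ) :
    imOfComp E X (dh E X h) (dh E X h') k ≤ imOf E X (dh E X h) k := by
  match k with
  | 0 => exact bot_le
  | 1 => exact bot_le
  | k + 2 =>
    rintro _ ⟨β, rfl⟩
    exact ⟨_, rfl⟩

theorem imOfComp_le_imOf_d (hne : h ≠ h') (k : ℕ) :
    imOfComp E X (dh E X h) (dh E X h') k ≤ imOf E X (d E X) k := by
  rw [imOfComp_dh_dh hne]
  match k with
  | 0 => exact bot_le
  | 1 => exact bot_le
  | k + 2 =>
    rintro _ ⟨β, rfl⟩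
    refine ⟨delbar E X k β, ?_⟩
    rw [d_eq_del_add_delbar, LinearMap.add_apply, delbar_delbar, add_zero]
    rfl

theorem ker_inf_ker_le_ker_d (hne : h ≠ h') (k : ℕ) :
    LinearMap.ker (dh E X h k) ⊓ LinearMap.ker (dh E X h' k) ≤ LinearMap.ker (d E X k) := by
  rw [ker_dh_inf_ker_dh hne]
  rintro u ⟨h1, h2⟩
  rw [SetLike.mem_coe, LinearMap.mem_ker] at h1 h2
  rw [LinearMap.mem_ker, d_eq_del_add_delbar, LinearMap.add_apply, h1, h2, add_zero]

theorem ker_dh_le_ker_comp (h h' : ℝ) (k : ℕ) :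
    LinearMap.ker (dh E X h k) ≤ LinearMap.ker (dh E X h (k + 1) ∘ₗ dh E X h' k) := by
  intro u hu
  rw [LinearMap.mem_ker] at hu
  rw [LinearMap.mem_ker, LinearMap.comp_apply, dh_dh_comm, hu, map_zero, neg_zero]

/-- On an `h`-`∂∂̄`-manifold, a `∂`- and `∂̄`-closed form that is exact for `d_h` or for `d_{-1/h}`
is the image of suitable exact forms under each of the operators `d_h`, `d_{-1/h}` and `∂`. -/
theorem IsHDelDelbarManifold.exists_primitives [FiniteDimensional ℂ E] (h0 : h ≠ 0)
    (hX : IsHDelDelbarManifold E X h) {k : ℕ} {v : Form E X (k + 1)}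
    (hv : v ∈ LinearMap.ker (dh E X h (k + 1)) ⊓ LinearMap.ker (dh E X (-(1 / h)) (k + 1)))
    (hex : v ∈ imOf E X (dh E X h) (k + 1) ∨ v ∈ imOf E X (dh E X (-(1 / h))) (k + 1)) :
    (∃ γ ∈ imOf E X (dh E X (-(1 / h))) k, dh E X h k γ = v) ∧
    (∃ γ ∈ imOf E X (dh E X h) k, dh E X (-(1 / h)) k γ = v) ∧
    (∃ γ ∈ imOf E X (d E X) k, del E X k γ = v ∧ delbar E X k γ = -v) := by
  have hne := ne_neg_one_div h0
  have hc : ((h : ℂ) - (-(1 / h) : ℝ)) ≠ 0 := sub_ne_zero.2 (Complex.ofReal_injective.ne hne)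
  have hc' : (((-(1 / h) : ℝ) : ℂ) - h) ≠ 0 :=
    sub_ne_zero.2 (Complex.ofReal_injective.ne hne.symm)
  have hmem : v ∈ imOfComp E X (dh E X h) (dh E X (-(1 / h))) (k + 1) := by
    by_cases hk : k + 1 ≤ 2 * Module.finrank ℂ E
    · have H := hX (k + 1) hk v hv
      exact hex.elim (H.out 0 3).1 (H.out 1 3).1
    -- In degree 2n + 1 the hypothesis says nothing, but alternating forms on a real space of
    -- dimension 2n vanish there.
    · rw [Form.eq_zero_of_finrank_lt (by omega) v]
      exact zero_mem _
  rw [imOfComp_dh_dh hne] at hmem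
  cases k with
  | zero =>
    rw [(Submodule.mem_bot ℂ).1 hmem]
    exact ⟨⟨0, zero_mem _, map_zero _⟩, ⟨0, zero_mem _, map_zero _⟩,
      ⟨0, zero_mem _, map_zero _, by rw [map_zero, neg_zero]⟩⟩
  | succ k =>
    obtain ⟨β, rfl⟩ := hmem
    -- With h' = -1/h and v = ∂∂̄β, the primitives are d_{h'}β/(h - h'), d_hβ/(h' - h) and dβ.
    refine ⟨⟨_, Submodule.smul_mem _ ((h : ℂ) - (-(1 / h) : ℝ))⁻¹ ⟨β, rfl⟩, ?_⟩,
      ⟨_, Submodule.smul_mem _ (((-(1 / h) : ℝ) : ℂ) - h)⁻¹ ⟨β, rfl⟩, ?_⟩, ⟨_, ⟨β, rfl⟩, ?_, ?_⟩⟩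
    · rw [map_smul, dh_dh, inv_smul_smul₀ hc]
      rfl
    · rw [map_smul, dh_dh, inv_smul_smul₀ hc']
      rfl
    · rw [d_eq_del_add_delbar, LinearMap.add_apply, map_add, del_del, zero_add]
      rfl
    · rw [d_eq_del_add_delbar, LinearMap.add_apply, map_add, delbar_delbar, add_zero, delbar_del]
      rfl

/-- For surjectivity, if α is d_h-closed then d_{-1/h}α = d_{-1/h}γ with γ in Im d_h, and α - γ is
closed for both operators. -/
theorem IsHDelDelbarManifold.bijective_HhBC_Hdh [FiniteDimensional ℂ E] (h0 : h ≠ 0)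
    (hX : IsHDelDelbarManifold E X h) {k : ℕ} (hk : k ≤ 2 * Module.finrank ℂ E)
    {S : HhBC E X h k →ₗ[ℂ] Hdh E X h k} (hS : IsCanonical S) : Function.Bijective S := by
  refine hS.bijective (fun α hα hB => ((hX k hk α hα).out 0 3).1 hB) fun α hα => ?_
  rw [LinearMap.mem_ker] at hα
  obtain ⟨-, ⟨γ, hγ, e⟩, -⟩ := hX.exists_primitives h0 (v := dh E X (-(1 / h)) k α)
    ⟨by rw [SetLike.mem_coe, LinearMap.mem_ker, dh_dh_comm, hα, map_zero, neg_zero], dh_dh_self _ k α⟩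
    (Or.inr ⟨α, rfl⟩)
  refine ⟨γ, hγ, ?_, ?_⟩
  · rw [SetLike.mem_coe, LinearMap.mem_ker, map_sub, hα, dh_eq_zero_of_mem_imOf hγ, sub_zero]
  · rw [SetLike.mem_coe, LinearMap.mem_ker, map_sub, e, sub_self]

/-- Injectivity: if a d_h-closed form is β + γ with β in Im d_h and γ in Im d_{-1/h}, then γ is
closed for both, hence d_h-exact. Surjectivity: d_hα = d_hγ with γ in Im d_{-1/h}, and α - γ is
d_h-closed. -/
theorem IsHDelDelbarManifold.bijective_Hdh_HhA [FiniteDimensional ℂ E] (h0 : h ≠ 0)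
    (hX : IsHDelDelbarManifold E X h) {k : ℕ} (hk : k ≤ 2 * Module.finrank ℂ E)
    {R : Hdh E X h k →ₗ[ℂ] HhA E X h k} (hR : IsCanonical R) : Function.Bijective R := by
  refine hR.bijective (fun α hα hB => ?_) fun α hα => ?_
  · obtain ⟨β, hβ, γ, hγ, rfl⟩ := Submodule.mem_sup.1 hB
    rw [LinearMap.mem_ker, map_add, dh_eq_zero_of_mem_imOf hβ, zero_add] at hα
    exact add_mem hβ
      (((hX k hk γ ⟨hα, dh_eq_zero_of_mem_imOf hγ⟩).out 1 0).1 hγ)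
  · rw [LinearMap.mem_ker, LinearMap.comp_apply] at hα
    obtain ⟨⟨γ, hγ, e⟩, -, -⟩ := hX.exists_primitives h0 (v := dh E X h k α)
      ⟨dh_dh_self _ k α, by
        rw [SetLike.mem_coe, LinearMap.mem_ker, dh_dh_comm, hα, neg_zero]⟩
      (Or.inl ⟨α, rfl⟩)
    refine ⟨γ, Submodule.mem_sup_right hγ, ?_⟩
    rw [LinearMap.mem_ker, map_sub, e, sub_self]

theorem IsHDelDelbarManifold.bijective_HhBC_HDR [FiniteDimensional ℂ E] (h0 : h ≠ 0)
    (hX : IsHDelDelbarManifold E X h) {k : ℕ} (hk : k ≤ 2 * Module.finrank ℂ E)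
    {T : HhBC E X h k →ₗ[ℂ] HDR E X k} (hT : IsCanonical T) : Function.Bijective T := by
  refine hT.bijective (fun α hα hB => ((hX k hk α hα).out 2 3).1 hB) fun α hα => ?_
  have hne := ne_neg_one_div h0
  rw [LinearMap.mem_ker, d_eq_del_add_delbar, LinearMap.add_apply] at hα
  have hbar : delbar E X k α = -del E X k α := (neg_eq_of_add_eq_zero_right hα).symm
  -- As ∂̄α = -∂α, one has d_t α = (t - 1)∂α. Since h and -1/h cannot both be 1, ∂α is exact for at
  -- least one of d_h and d_{-1/h}.
  have hdh : ∀ t : ℝ, t ≠ 1 → del E X k α ∈ imOf E X (dh E X t) (k + 1) := by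
    intro t ht
    have ht' : (t : ℂ) - 1 ≠ 0 := sub_ne_zero.2 (by exact_mod_cast ht)
    refine ⟨((t : ℂ) - 1)⁻¹ • α, ?_⟩
    rw [map_smul, dh_apply, hbar, inv_smul_eq_iff₀ ht']
    module
  have hex : del E X k α ∈ imOf E X (dh E X h) (k + 1) ∨
      del E X k α ∈ imOf E X (dh E X (-(1 / h))) (k + 1) := by
    by_cases h1 : h = 1
    · exact Or.inr (hdh _ fun e => hne (h1.trans e.symm))
    · exact Or.inl (hdh h h1)
  have hclosed : delbar E X (k + 1) (del E X k α) = 0 := by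
    rw [delbar_del, hbar, map_neg, del_del, neg_zero, neg_zero]
  obtain ⟨-, -, γ, hγ, e1, e2⟩ := hX.exists_primitives h0 (v := del E X k α)
    (by rw [ker_dh_inf_ker_dh hne]; exact ⟨del_del k α, hclosed⟩) hex
  refine ⟨γ, hγ, ?_⟩
  rw [ker_dh_inf_ker_dh hne]
  constructor
  · rw [SetLike.mem_coe, LinearMap.mem_ker, map_sub, e1, sub_self]
  · rw [SetLike.mem_coe, LinearMap.mem_ker, map_sub, e2, hbar, sub_self]

end Manifold

end HTwisted

open HTwisted in
theorem lemma4p13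
    {E : Type*} [NormedAddCommGroup E] [NormedSpace ℂ E] [FiniteDimensional ℂ E]
    {X : Type*} [TopologicalSpace X] [T2Space X] [CompactSpace X]
    [ChartedSpace E X] [IsManifold 𝓘(ℂ, E) ω X] :
    -- (a)
    (∀ h : ℝ, h ≠ 0 → ∀ k ≤ 2 * Module.finrank ℂ E,
      ∃ T : HhBC E X h k →ₗ[ℂ] HhA E X h k,
        IsCanonical T ∧ (IsHDelDelbarManifold E X h → Function.Bijective T)) ∧
    -- (b)
    (∀ k ≤ 2 * Module.finrank ℂ E,
      (∀ h : ℝ, h ≠ 0 →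
        (∃ Φ : (DirectSum {pq : ℕ × ℕ // pq.1 + pq.2 = k} fun pq => HBC E X k pq.1.1 pq.1.2)
            ≃ₗ[ℂ] HhBC E X h k,
          ∀ pq, IsCanonical (Φ.toLinearMap ∘ₗ DirectSum.lof ℂ {pq : ℕ × ℕ // pq.1 + pq.2 = k}
            (fun pq => HBC E X k pq.1.1 pq.1.2) pq)) ∧
        (∃ Ψ : (DirectSum {pq : ℕ × ℕ // pq.1 + pq.2 = k} fun pq => HA E X k pq.1.1 pq.1.2)
            ≃ₗ[ℂ] HhA E X h k,
          ∀ pq, IsCanonical (Ψ.toLinearMap ∘ₗ DirectSum.lof ℂ {pq : ℕ × ℕ // pq.1 + pq.2 = k}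
            (fun pq => HA E X k pq.1.1 pq.1.2) pq))) ∧
      (∀ h h' : ℝ, h ≠ 0 → h' ≠ 0 →
        Module.rank ℂ (HhBC E X h k) = Module.rank ℂ (HhBC E X h' k) ∧
        Module.rank ℂ (HhA E X h k) = Module.rank ℂ (HhA E X h' k))) ∧
    -- (c)
    (∀ h : ℝ, h ≠ 0 → ∀ k ≤ 2 * Module.finrank ℂ E,
      ∃ (S : HhBC E X h k →ₗ[ℂ] Hdh E X h k) (R : Hdh E X h k →ₗ[ℂ] HhA E X h k),
        IsCanonical S ∧ IsCanonical R ∧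
        (IsHDelDelbarManifold E X h →
          Function.Bijective S ∧ Function.Bijective R ∧
          Module.rank ℂ (HhBC E X h k) = betti E X k ∧
          Module.rank ℂ (Hdh E X h k) = betti E X k ∧
          Module.rank ℂ (HhA E X h k) = betti E X k)) := by
  have hS : ∀ (h : ℝ) (k : ℕ), ∃ S : HhBC E X h k →ₗ[ℂ] Hdh E X h k, IsCanonical S :=
    fun h k => ⟨_, isCanonical_canonicalMap inf_le_left (imOfComp_le_imOf h _ k)⟩
  have hR : ∀ (h : ℝ) (k : ℕ), ∃ R : Hdh E X h k →ₗ[ℂ] HhA E X h k, IsCanonical R :=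
    fun h k => ⟨_, isCanonical_canonicalMap (ker_dh_le_ker_comp h _ k) le_sup_left⟩
  refine ⟨fun h h0 k hk => ?_, fun k _ => ⟨fun h h0 => ⟨exists_directSum_HBC_equiv h0 k,
    exists_directSum_HA_equiv h0 k⟩, fun h h' h0 h0' => ⟨?_, ?_⟩⟩, fun h h0 k hk => ?_⟩
  · obtain ⟨S, hS⟩ := hS h k
    obtain ⟨R, hR⟩ := hR h k
    exact ⟨R ∘ₗ S, hR.comp hS, fun hX =>
      (hX.bijective_Hdh_HhA h0 hk hR).comp (hX.bijective_HhBC_Hdh h0 hk hS)⟩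
  · obtain ⟨Φ, -⟩ := exists_directSum_HBC_equiv (E := E) (X := X) h0 k
    obtain ⟨Φ', -⟩ := exists_directSum_HBC_equiv (E := E) (X := X) h0' k
    exact (Φ.symm.trans Φ').rank_eq
  · obtain ⟨Ψ, -⟩ := exists_directSum_HA_equiv (E := E) (X := X) h0 k
    obtain ⟨Ψ', -⟩ := exists_directSum_HA_equiv (E := E) (X := X) h0' k
    exact (Ψ.symm.trans Ψ').rank_eq
  · obtain ⟨S, hS⟩ := hS h k
    obtain ⟨R, hR⟩ := hR h k
    refine ⟨S, R, hS, hR, fun hX => ?_⟩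
    have bS := hX.bijective_HhBC_Hdh h0 hk hS
    have bR := hX.bijective_Hdh_HhA h0 hk hR
    have hne := ne_neg_one_div h0
    -- The Betti number enters through h-Bott-Chern cohomology, which maps canonically to de Rham
    -- cohomology; the other two dimensions follow along `S` and `R`.
    have bT := hX.bijective_HhBC_HDR h0 hk
      (isCanonical_canonicalMap (ker_inf_ker_le_ker_d hne k) (imOfComp_le_imOf_d hne k))
    have eT : Module.rank ℂ (HhBC E X h k) = betti E X k :=
      (LinearEquiv.ofBijective _ bT).rank_eq
    have eS : Module.rank ℂ (Hdh E X h k) = betti E X k :=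
      (LinearEquiv.ofBijective S bS).rank_eq.symm.trans eT
    exact ⟨bS, bR, eT, eS, (LinearEquiv.ofBijective R bR).rank_eq.symm.trans eS⟩
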